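/- Setting. Let $\mathbf V$ be a fixed finite set of variables. A \emph{recursive linear Gaussian structural equation model} $M$ over $\mathbf V$ consists of a DAG $G_M$ on $\mathbf V$, real structural coefficients $e_M(X\to Y)$ (equal to $0$ if $X\to Y$ is not an edge of $G_M$; a coefficient of an edge may also vanish) and mutually independent error terms $\varepsilon_Y\sim\mathcal N(0,\sigma_Y^2)$, $\sigma_Y^2>0$. It determines the law $P_M$ of $\mathbf V$ by $Y=\sum_X e_M(X\to Y)X+\varepsilon_Y$. (Thus $\mathbf V$ is causally sufficient and $P_M$ satisfies the Markov condition for $G_M$.) For adjacent $X,Z$ let $e_M(X - Z)$ be the coefficient of the edge between them, and let $\rho_M(X,Z|\mathbf W)$ be the partial correlation under $P_M$. For $k>0$, $J>0$, $C<1$ let $\psi^{k,J,C}$ be the set of all such $M$ for which every variable has variance $1$ and * ($k$-Triangle-Faithfulness) for all pairwise adjacent $X,Y,Z$ in $G_M$, $|\rho_M(X,Z|\mathbf W)|\ge k\,|e_M(X - Z)|$ for all $\mathbf W\subseteq\mathbf V\setminus\{X,Z\}$ with $Y\notin\mathbf W$ if $X\to Y\leftarrow Z$ does not hold in $G_M$,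 and for all $\mathbf W\subseteq\mathbf V\setminus\{X,Z\}$ with $Y\in\mathbf W$ if it does; * (NVV($J$)) $\operatorname{var}_M(X|\mathbf V\setminus\{X\})\ge J$ for all $X$; * (UBC($C$)) $|\rho_M(X,Y|\mathbf W)|\le C$ for all $X\ne Y$ and $\mathbf W\subseteq\mathbf V\setminus\{X,Y\}$. Tests. Fix $L>0$. A test is a sequence of functions $\varphi_n$ of the i.i.d. sample of size $n$ with value $0$ (accept) or $1$ (reject). A test of $\theta=0$ against $\theta\neq0$ is uniformly consistent (with respect to $\psi^{k,J,C}$) if $\sup_{M:\theta(P_M)=0}P_M^n(\varphi_n=1)\to0$ and $\sup_{M:|\theta(P_M)|\ge\eta}P_M^n(\varphi_n=0)\to0$ for every $\eta>0$; a test of $|\theta|\ge L$ against $|\theta|<L$ is uniformly consistent if $\sup_{M:|\theta(P_M)|\ge L}P_M^n(\varphi_n=1)\to0$ and $\sup_{M:|\theta(P_M)|\le L-\eta}P_M^n(\varphi_n=0)\to0$ for every $\eta>0$ (suprema over $M\in\psi^{k,J,C}$). For every unordered pair $\{X,Z\}$ and all $\mathbf U,\mathbf W\subseteq\mathbf V\setminus\{X,Z\}$,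 let uniformly consistent tests of $\rho(X,Z|\mathbf W)=0$ and of $|\rho(X,Z|\mathbf U)-\rho(X,Z|\mathbf W)|\ge L$ be given. Edge Estimation algorithm. Below, sets $\mathbf S,\mathbf W,\mathbf U$ are subsets of $\mathbf V$ minus the two variables tested. 1. (CSGS, adjacencies) $X\neq Y$ are adjacent iff the test of $\rho(X,Y|\mathbf S)=0$ rejects for every $\mathbf S$. 2. (CSGS, triples) For each unshielded triple $\langle X,Y,Z\rangle$ (that is, $X,Y$ and $Y,Z$ are adjacent, and $X\ne Z$ are not): if there is $\mathbf W\not\ni Y$ such that $\rho(X,Z|\mathbf W)=0$ is accepted and, for every $\mathbf U\ni Y$, $\rho(X,Z|\mathbf U)=0$ is rejected and $|\rho(X,Z|\mathbf U)-\rho(X,Z|\mathbf W)|\ge L$ is accepted, orient $X\to Y\leftarrow Z$; if this holds with the roles of "containing $Y$" and "not containing $Y$" interchanged, mark the triple as a noncollider; otherwise it is ambiguous. 3. (CSGS, orientation rules) Apply the following rules, in any order, until none applies: (i) if $X\to Y - Z$ and $\langle X,Y,Z\rangle$ is marked as a noncollider, orient $Y\to Z$; (ii) if $X\to Y\to Z$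 and $X - Z$, orient $X\to Z$; (iii) if $X\to Y\leftarrow Z$, $\langle X,W,Z\rangle$ is marked as a noncollider and $W - Y$, orient $W\to Y$. 4. (Markov test V5) Consider every DAG $G$ which has exactly the adjacencies of the resulting graph $O$, all its arrowheads and none of its marked noncolliders as a collider; these are the DAGs represented by the patterns that result from consistent disambiguations of the ambiguous triples. The nonadjacencies are confirmed iff for every such $G$, every $X$ and every $Y\neq X$ that is neither a parent nor a descendant of $X$ in $G$, the test of $\rho(X,Y|\mathbf{Parents}(G,X))=0$ accepts. 5. If the nonadjacencies are not confirmed, all estimates are "Unknown". If they are, then $\hat e(X\to Y)=\hat e(Y\to X)=0$ for nonadjacent $X,Y$; for each $Z$ all of whose edges are oriented in $O$ and each parent $Y$ of $Z$ in $O$, $\hat e(Y\to Z)$ is the coefficient of $Y$ in the sample least squares regression (with intercept) of $Z$ on its parents in $O$, and $\hat e(Z\to Y)=0$; for the remaining edges the estimate is "Unknown". For an output $\hat O$ let $d[\hat O,M]=\max_{X,Y}|\hat e(X\to Y)-e_M(X\to Y)|$, where the difference counts as $0$ if $\hat e(X\to Y)$ is "Unknown". Theorem. For all $k>0$, $J>0$,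 $C<1$, $L>0$ and all uniformly consistent tests as above, the Edge Estimation algorithm is uniformly consistent: for every $\delta>0$, $$\lim_{n\to\infty}\ \sup_{M\in\psi^{k,J,C}}P_M^n\bigl(d[\hat O(M),M]>\delta\bigr)=0,$$ where $\hat O(M)$ is the output of the algorithm on an i.i.d. sample of size $n$ from $P_M$ (the event being that some output that the algorithm can reach on the sample, under some order of the orientation rules, has distance greater than $\delta$). -/

import Mathlib

open MeasureTheory ProbabilityTheory Filter Topology
open scoped NNReal ENNReal

noncomputable section

/-! ### Distributions on `ℝ^V`: conditional covariances, partial correlations, samples -/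

section Distribution

variable {V : Type*}

/-- Law of an i.i.d. sample of size `n` from `P`; the sample is `D : Fin n → V → ℝ`, with `D t x`
the value of the variable `x` in the `t`-th unit. -/
def iidSample [Fintype V] (P : Measure (V → ℝ)) (n : ℕ) : Measure (Fin n → V → ℝ) :=
  Measure.pi fun _ : Fin n => P

/-- Covariance of the variables `x` and `y` under `P`. -/
def covP (P : Measure (V → ℝ)) (x y : V) : ℝ :=
  covariance (fun ω : V → ℝ => ω x) (fun ω : V → ℝ => ω y) P

variable [DecidableEq V]

/-- Conditional covariance of `x` and `y` given `W` for a Gaussian `P` with nonsingular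
covariance matrix: `Σ_xy - Σ_xW (Σ_WW)⁻¹ Σ_Wy`. -/
def condCov (P : Measure (V → ℝ)) (W : Finset V) (x y : V) : ℝ :=
  covP P x y - ∑ s : W, ∑ t : W,
    covP P x s * (Matrix.of fun a b : W => covP P a b)⁻¹ s t * covP P t y

/-- Conditional variance of `x` given `W`. -/
def gaussCondVar (P : Measure (V → ℝ)) (x : V) (W : Finset V) : ℝ := condCov P W x x

/-- Partial correlation `ρ_P(x, y | W)`. -/
def partialCorr (P : Measure (V → ℝ)) (x y : V) (W : Finset V) : ℝ :=
  condCov P W x y / √(condCov P W x x * condCov P W y y)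

end Distribution

/-! ### Recursive linear Gaussian structural equation models -/

/-- A directed graph is acyclic if no vertex is reached from itself by a nonempty directed path. -/
def Digraph.IsDAG {V : Type*} (G : Digraph V) : Prop := ∀ x, ¬ Relation.TransGen G.Adj x x

/-- `x` and `y` are adjacent in `G` (the edge may have either direction). -/
def Digraph.Adjacent {V : Type*} (G : Digraph V) (x y : V) : Prop := G.Adj x y ∨ G.Adj y x

/-- `x → y ← z` in `G`. -/
def Digraph.Collider {V : Type*} (G : Digraph V) (x y z : V) : Prop := G.Adj x y ∧ G.Adj z y

open Classical in
/-- The set of parents of `x` in `G`. -/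
def Digraph.parents {V : Type*} [Fintype V] (G : Digraph V) (x : V) : Finset V :=
  Finset.univ.filter fun y => G.Adj y x

/-- A recursive linear Gaussian structural equation model over `V`: a DAG, the structural
coefficients (`coef x y` is the coefficient of the edge `x → y`; a coefficient of an edge may
vanish), and the variances of the error terms, which are independent centred Gaussians. -/
structure LinGaussSEM (V : Type*) where
  graph : Digraph V
  isDAG : graph.IsDAG
  coef : V → V → ℝ
  coef_eq_zero : ∀ x y, ¬ graph.Adj x y → coef x y = 0
  errVar : V → ℝ≥0
  errVar_pos : ∀ x, 0 < errVar x

namespace LinGaussSEM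

variable {V : Type*} [Fintype V] [DecidableEq V]

/-- The matrix `B` of the structural equations `X = B X + ε`. -/
def coefMatrix (M : LinGaussSEM V) : Matrix V V ℝ := Matrix.of fun y x => M.coef x y

/-- Joint law of the error terms. -/
def errLaw (M : LinGaussSEM V) : Measure (V → ℝ) := Measure.pi fun x => gaussianReal 0 (M.errVar x)

/-- The solution `X = (1 - B)⁻¹ ε` of the structural equations with error terms `ε`. -/
def solution (M : LinGaussSEM V) (ε : V → ℝ) : V → ℝ :=
  ((1 : Matrix V V ℝ) - M.coefMatrix)⁻¹.mulVec ε

/-- The distribution `P_M` of the variables of the model. -/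
def law (M : LinGaussSEM V) : Measure (V → ℝ) := M.errLaw.map M.solution

theorem isUnit_one_sub_coefMatrix (M : LinGaussSEM V) :
    IsUnit ((1 : Matrix V V ℝ) - M.coefMatrix) := by
  rw [← Matrix.mulVec_injective_iff_isUnit]
  rw [← Matrix.coe_mulVecLin, ← LinearMap.ker_eq_bot, LinearMap.ker_eq_bot']
  intro v hv
  have hfix : ∀ y, v y = ∑ x, M.coef x y * v x := by
    intro y
    have h := congrFun hv y
    simp only [Matrix.mulVecLin_apply, Matrix.sub_mulVec, Matrix.one_mulVec, Pi.sub_apply,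
      Pi.zero_apply] at h
    have h2 : M.coefMatrix.mulVec v y = ∑ x, M.coef x y * v x := rfl
    linarith
  have : IsTrans V (Relation.TransGen M.graph.Adj) := ⟨fun _ _ _ => Relation.TransGen.trans⟩
  have : Std.Irrefl (Relation.TransGen M.graph.Adj) := ⟨M.isDAG⟩
  have wf := Finite.wellFounded_of_trans_of_irrefl (Relation.TransGen M.graph.Adj)
  funext y
  induction y using wf.induction with
  | _ y ih =>
    rw [hfix y]
    refine Finset.sum_eq_zero fun x _ => ?_
    by_cases hxy : M.graph.Adj x y
    · rw [ih x (Relation.TransGen.single hxy)]; simp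
    · rw [M.coef_eq_zero x y hxy]; simp

/-- `M.solution ε` is indeed the solution of the structural equations. -/
theorem solution_iff (M : LinGaussSEM V) (ε X : V → ℝ) :
    X = M.solution ε ↔ ∀ y, X y = ∑ x, M.coef x y * X x + ε y := by
  have hu := M.isUnit_one_sub_coefMatrix
  have hdet := (Matrix.isUnit_iff_isUnit_det _).1 hu
  have key : (∀ y, X y = ∑ x, M.coef x y * X x + ε y) ↔
      ((1 : Matrix V V ℝ) - M.coefMatrix).mulVec X = ε := by
    rw [funext_iff]
    refine forall_congr' fun y => ?_
    have h2 : M.coefMatrix.mulVec X y = ∑ x, M.coef x y * X x := rfl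
    rw [Matrix.sub_mulVec, Matrix.one_mulVec, Pi.sub_apply, h2]
    constructor <;> intro h <;> linarith
  rw [key]
  constructor
  · rintro rfl
    simp [solution, Matrix.mulVec_mulVec, Matrix.mul_nonsing_inv _ hdet]
  · rintro rfl
    simp [solution, Matrix.mulVec_mulVec, Matrix.nonsing_inv_mul _ hdet]

open Classical in
/-- Structural coefficient `e_M(x — z)` of the edge between two adjacent variables, whatever
its direction. -/
def edgeCoef (M : LinGaussSEM V) (x z : V) : ℝ :=
  if M.graph.Adj x z then M.coef x z else M.coef z x

/-- All variables have variance `1` (their means are `0` because the errors are centred). -/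
def Standardized (M : LinGaussSEM V) : Prop := ∀ x, covP M.law x x = 1

/-- The `k`-Triangle-Faithfulness assumption. -/
def KTriangleFaithful (M : LinGaussSEM V) (k : ℝ) : Prop :=
  ∀ x y z, M.graph.Adjacent x y → M.graph.Adjacent y z → M.graph.Adjacent x z →
    (¬ M.graph.Collider x y z → ∀ W : Finset V, x ∉ W → z ∉ W → y ∉ W →
      k * |M.edgeCoef x z| ≤ |partialCorr M.law x z W|) ∧
    (M.graph.Collider x y z → ∀ W : Finset V, x ∉ W → z ∉ W → y ∈ W →
      k * |M.edgeCoef x z| ≤ |partialCorr M.law x z W|)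

/-- Assumption NVV(`J`): nonvanishing variance. -/
def NVV (M : LinGaussSEM V) (J : ℝ) : Prop :=
  ∀ x, J ≤ gaussCondVar M.law x (Finset.univ.erase x)

/-- Assumption UBC(`C`): upper bound for partial correlations. -/
def UBC (M : LinGaussSEM V) (C : ℝ) : Prop :=
  ∀ x y, x ≠ y → ∀ W : Finset V, x ∉ W → y ∉ W → |partialCorr M.law x y W| ≤ C

end LinGaussSEM

/-- The class `ψ^{k,J,C}` of causal models over `V`. -/
def modelClass (V : Type*) [Fintype V] [DecidableEq V] (k J C : ℝ) : Set (LinGaussSEM V) :=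
  {M | M.Standardized ∧ M.KTriangleFaithful k ∧ M.NVV J ∧ M.UBC C}

/-! ### Tests -/

/-- A family `φ n` of tests (value `0`: accept, value `1`: reject) of `H₀ : θ = 0` against
`H₁ : θ ≠ 0` is uniformly consistent with respect to the set `Ω` of distributions. -/
def UniformlyConsistentZero {V : Type*} [Fintype V] (Ω : Set (Measure (V → ℝ)))
    (θ : Measure (V → ℝ) → ℝ) (φ : (n : ℕ) → (Fin n → V → ℝ) → Fin 2) : Prop :=
  Tendsto (fun n => ⨆ P ∈ Ω, ⨆ _ : θ P = 0, iidSample P n {D | φ n D = 1}) atTop (𝓝 0) ∧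
  ∀ δ : ℝ, 0 < δ →
    Tendsto (fun n => ⨆ P ∈ Ω, ⨆ _ : δ ≤ |θ P|, iidSample P n {D | φ n D = 0}) atTop (𝓝 0)

/-- A family `φ n` of tests (value `0`: accept, value `1`: reject) of `H₀ : |θ| ≥ L` against
`H₁ : |θ| < L` is uniformly consistent with respect to the set `Ω` of distributions. -/
def UniformlyConsistentGe {V : Type*} [Fintype V] (Ω : Set (Measure (V → ℝ))) (L : ℝ)
    (θ : Measure (V → ℝ) → ℝ) (φ : (n : ℕ) → (Fin n → V → ℝ) → Fin 2) : Prop :=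
  Tendsto (fun n => ⨆ P ∈ Ω, ⨆ _ : L ≤ |θ P|, iidSample P n {D | φ n D = 1}) atTop (𝓝 0) ∧
  ∀ δ : ℝ, 0 < δ →
    Tendsto (fun n => ⨆ P ∈ Ω, ⨆ _ : |θ P| ≤ L - δ, iidSample P n {D | φ n D = 0}) atTop (𝓝 0)

/-- The tests that the algorithm calls, one for every unordered pair of variables and every
conditioning set (or pair of conditioning sets): `zero n x z W` is the test of
`ρ(x, z | W) = 0`, and `diff n x z U W` the test of `|ρ(x, z | U) - ρ(x, z | W)| ≥ L`. -/
structure TestFamily (V : Type*) where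
  zero : (n : ℕ) → V → V → Finset V → (Fin n → V → ℝ) → Fin 2
  zero_symm : ∀ n x z W, zero n x z W = zero n z x W
  diff : (n : ℕ) → V → V → Finset V → Finset V → (Fin n → V → ℝ) → Fin 2
  diff_symm : ∀ n x z U W, diff n x z U W = diff n z x U W

/-- All tests of the family are uniformly consistent with respect to `Ω`. -/
def TestFamily.UniformlyConsistent {V : Type*} [Fintype V] [DecidableEq V] (T : TestFamily V)
    (L : ℝ) (Ω : Set (Measure (V → ℝ))) : Prop :=
  (∀ x z W, x ≠ z → x ∉ W → z ∉ W →
    UniformlyConsistentZero Ω (fun P => partialCorr P x z W) fun n => T.zero n x z W) ∧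
  (∀ x z U W, x ≠ z → x ∉ U → z ∉ U → x ∉ W → z ∉ W →
    UniformlyConsistentGe Ω L (fun P => partialCorr P x z U - partialCorr P x z W)
      fun n => T.diff n x z U W)

/-! ### The sample version of the CSGS algorithm -/

section CSGS

variable {V : Type*} (T : TestFamily V) (n : ℕ) (D : Fin n → V → ℝ)

/-- Steps S1 and S2: the edge between `x` and `y` stays iff no set `S` is found with
`ρ(x, y | S) = 0` accepted. -/
def KAdj (x y : V) : Prop :=
  x ≠ y ∧ ∀ S : Finset V, x ∉ S → y ∉ S → T.zero n x y S D = 1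

/-- Unshielded triples of the graph from S2. -/
def KUnshielded (x y z : V) : Prop :=
  x ≠ z ∧ KAdj T n D x y ∧ KAdj T n D y z ∧ ¬ KAdj T n D x z

/-- Step S3*, clause 1: the triple is oriented as a collider `x → y ← z`. -/
def MarkCollider (x y z : V) : Prop :=
  KUnshielded T n D x y z ∧
  ∃ W : Finset V, x ∉ W ∧ z ∉ W ∧ y ∉ W ∧ T.zero n x z W D = 0 ∧
    ∀ U : Finset V, x ∉ U → z ∉ U → y ∈ U →
      T.zero n x z U D = 1 ∧ T.diff n x z U W D = 0

/-- Step S3*, clause 2: the triple is marked as a noncollider. -/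
def MarkNoncollider (x y z : V) : Prop :=
  KUnshielded T n D x y z ∧
  ∃ W : Finset V, x ∉ W ∧ z ∉ W ∧ y ∈ W ∧ T.zero n x z W D = 0 ∧
    ∀ U : Finset V, x ∉ U → z ∉ U → y ∉ U →
      T.zero n x z U D = 1 ∧ T.diff n x z U W D = 0

end CSGS

/-- A graph as handled by the algorithm: `adj` are the edges, `head x y` says that the edge between
`x` and `y` carries an arrowhead at `y`, and `noncol` are the triples marked as noncolliders.
An edge without arrowhead is undirected; sampling errors can produce double-headed edges.
(Unshielded triples that are neither oriented as colliders nor marked as noncolliders are the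
ambiguous ones.) -/
structure ExtPattern (V : Type*) where
  adj : V → V → Prop
  head : V → V → Prop
  noncol : V → V → V → Prop

namespace ExtPattern

variable {V : Type*}

/-- `x → y`. -/
def Directed (O : ExtPattern V) (x y : V) : Prop := O.adj x y ∧ O.head x y ∧ ¬ O.head y x

/-- `x — y`, unoriented. -/
def Undirected (O : ExtPattern V) (x y : V) : Prop := O.adj x y ∧ ¬ O.head x y ∧ ¬ O.head y x

/-- One of the orientation rules of step S4 orients `y — z` as `y → z`. -/
def Orientable (O : ExtPattern V) (y z : V) : Prop :=
  O.Undirected y z ∧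
    ((∃ x, O.Directed x y ∧ O.noncol x y z) ∨
     (∃ x, O.Directed y x ∧ O.Directed x z) ∨
     (∃ x w, O.Directed x z ∧ O.Directed w z ∧ O.noncol x y w))

/-- `O'` results from `O` by one application of an orientation rule. -/
def Step (O O' : ExtPattern V) : Prop :=
  ∃ y z, O.Orientable y z ∧
    O' = { O with head := fun a b => O.head a b ∨ (a = y ∧ b = z) }

end ExtPattern

/-- The graph that results from step S3*. -/
def afterS3 {V : Type*} (T : TestFamily V) (n : ℕ) (D : Fin n → V → ℝ) : ExtPattern V where
  adj := KAdj T n D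
  head x y := ∃ z, MarkCollider T n D x y z
  noncol := MarkNoncollider T n D

/-- `O` is an output of the CSGS algorithm on the data `D`: the rules of S4 have been applied, in
some order, until none of them applies. -/
def IsCSGSOutput {V : Type*} (T : TestFamily V) (n : ℕ) (D : Fin n → V → ℝ)
    (O : ExtPattern V) : Prop :=
  Relation.ReflTransGen ExtPattern.Step (afterS3 T n D) O ∧ ∀ y z, ¬ O.Orientable y z

/-! ### The Markov test V5 -/

namespace ExtPattern

variable {V : Type*} [Fintype V] (O : ExtPattern V)

/-- The DAG `G` belongs to the Markov equivalence class of some pattern that results from a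
consistent disambiguation of the ambiguous triples of `O`: it has the adjacencies of `O`, the
arrowheads of `O`, and the marked noncolliders of `O`, while the ambiguous triples are free. -/
def Represents (G : Digraph V) : Prop :=
  G.IsDAG ∧ (∀ x y, G.Adjacent x y ↔ O.adj x y) ∧ (∀ x y, O.head x y → G.Adj x y) ∧
    ∀ x y z, O.noncol x y z → ¬ G.Collider x y z

/-- Step V5: every pattern in the set represented by `O` passes the test of the Markov condition.
A pattern satisfies the Markov condition when every DAG `G` represented by it does, that is, when
each variable `x` is independent of its nondescendants `y` that are not its parents, given its
parents; this is decided by the tests of zero partial correlations. -/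
def Confirmed (T : TestFamily V) (n : ℕ) (D : Fin n → V → ℝ) : Prop :=
  ∀ G : Digraph V, O.Represents G → ∀ x y, x ≠ y → ¬ G.Adj y x →
    ¬ Relation.TransGen G.Adj x y → T.zero n x y (G.parents x) D = 0

/-- All edges that contain `z` are oriented in `O`. -/
def FullyOriented (z : V) : Prop := ∀ y, O.adj y z → O.Directed y z ∨ O.Directed z y

open Classical in
/-- The parents of `z` in `O`. -/
def parents (z : V) : Finset V := Finset.univ.filter fun y => O.Directed y z

end ExtPattern

/-! ### The Edge Estimation algorithm -/

/-- `β` (restricted to `S`) are the sample regression coefficients of the variables in `S`, in a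
least squares regression with intercept of the variable `z` on `S`. -/
def IsOLS {V : Type*} {n : ℕ} (D : Fin n → V → ℝ) (z : V) (S : Finset V) (β : V → ℝ) : Prop :=
  ∃ a : ℝ, ∀ (a' : ℝ) (β' : V → ℝ),
    ∑ t, (D t z - a - ∑ s ∈ S, β s * D t s) ^ 2 ≤ ∑ t, (D t z - a' - ∑ s ∈ S, β' s * D t s) ^ 2

open Classical in
/-- The estimates `ê(x → y)` in step E4, where `none` is the answer "Unknown" and `β z` are the
coefficients of the regression of `z` on its parents in `O`: `0` for nonadjacent pairs; if all edges
containing `y` are oriented and `x` is a parent of `y`, the regression coefficient for `x → y`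
and `0` for the absent edge `y → x`; "Unknown" for the remaining edges. -/
def edgeEstimate {V : Type*} (O : ExtPattern V) (β : V → V → ℝ) (x y : V) : Option ℝ :=
  if ¬ O.adj x y then some 0
  else if O.FullyOriented y ∧ O.Directed x y then some (β y x)
  else if O.FullyOriented x ∧ O.Directed y x then some 0
  else none

/-- `e` is an output of the Edge Estimation algorithm on the data `D`. (It is unique up to the order
in which orientation rules are applied and the choice of a least squares solution where
the solution is not unique.) -/
def IsEdgeEstimationOutput {V : Type*} [Fintype V] (T : TestFamily V) (n : ℕ)
    (D : Fin n → V → ℝ) (e : V → V → Option ℝ) : Prop :=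
  ∃ O : ExtPattern V, IsCSGSOutput T n D O ∧
    ((¬ O.Confirmed T n D ∧ e = fun _ _ => none) ∨
     (O.Confirmed T n D ∧ ∃ β : V → V → ℝ, (∀ z, IsOLS D z (O.parents z) (β z)) ∧
        e = edgeEstimate O β))

/-- `|r - e|`, with the convention that the answer "Unknown" is at distance `0`. -/
def estDist : Option ℝ → ℝ → ℝ
  | none, _ => 0
  | some r, e => |r - e|

/-- Structural coefficient distance between an output and a causal model: the maximum over all
ordered pairs of variables. -/
def coefDist {V : Type*} (e : V → V → Option ℝ) (M : LinGaussSEM V) : ℝ :=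
  ⨆ p : V × V, estDist (e p.1 p.2) (M.coef p.1 p.2)

end

/-!
The proof separates a deterministic statement from a union bound. Call a sample from `M`
*`η`-accurate* (`SampleAccurate`) if the tests of `ρ = 0` are right where `ρ = 0` or `|ρ| ≥ η`,
the tests of `|θ| ≥ L` reject where `|θ| ≤ L - η`, and all sample moments are within `η` of their
expectations. By the uniform consistency of the finitely many tests and Chebyshev's inequality,
the samples that are not `η`-accurate are uniformly negligible
(`uniformlyNegligible_not_sampleAccurate`). It remains to find, for every `δ`, an `η` such that
every output on an `η`-accurate sample is within `δ` of `M` (`exists_accuracy`).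

If there is none, counterexamples with `η → 0` have, along a nonprincipal ultrafilter, a constant
graph `G`, converging coefficients and converging covariance matrices; by NVV(`J`) the limit
matrix is nonsingular, so partial correlations and regression coefficients converge too. The limit
is a linear model on `G` (`CovModel`) in which some coefficients may vanish, and eventually every
accepted hypothesis holds in the limit (`eventually_testsSound`). In this situation:

* Every adjacency found by the algorithm is one of `G`.
* No triple is marked wrongly (`TestsSound.false_of_mark`). Two variables without a direct effect
  on each other are separated by a set that contains a given noncollider and by one that avoids a
  given collider (`CovModel.exists_separator`). If the tested pair is adjacent in `G`, then
  Triangle-Faithfulness shows that its coefficient vanishes in the limit, so this applies to it as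
  well.
* Hence the orientation rules produce only arrowheads of `G` (`TestsSound.csgs_sound`), and `G`
  restricted to the adjacencies found is among the DAGs that the Markov test examines. If the test
  confirms the nonadjacencies, the limit satisfies the Markov condition for this subgraph, so the
  edges that were missed have coefficient `0` in the limit (`CovModel.coef_eq_zero_of_markov`),
  and the structural coefficients of a fully oriented variable are its regression coefficients on
  the parents found (`TestsSound.output_sound`).

So the estimates and the coefficients have the same limits, a contradiction.
-/

noncomputable section

/-! ### Conditional covariances and regression for covariance matrices -/

section LinearAlgebra

open Matrix

variable {V : Type*}

/-- The matrix of covariances of the variables under `P`. -/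
def covMatrix (P : Measure (V → ℝ)) : Matrix V V ℝ := Matrix.of (covP P)

theorem isSymm_covMatrix (P : Measure (V → ℝ)) : (covMatrix P).IsSymm := by
  ext x y
  exact covariance_comm _ _

section

variable [DecidableEq V]

/-- The conditional covariance of `x` and `y` given `W` as a function of the covariance matrix;
`condCov P` unfolds to `schurCov (covMatrix P)`. -/
def schurCov (S : Matrix V V ℝ) (W : Finset V) (x y : V) : ℝ :=
  S x y - ∑ s : W, ∑ t : W, S x s * (Matrix.of fun a b : W => S a b)⁻¹ s t * S t y

/-- The partial correlation of `x` and `y` given `W` as a function of the covariance matrix;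
`partialCorr P` unfolds to `schurCorr (covMatrix P)`. -/
def schurCorr (S : Matrix V V ℝ) (x y : V) (W : Finset V) : ℝ :=
  schurCov S W x y / √(schurCov S W x x * schurCov S W y y)

theorem schurCov_comm {S : Matrix V V ℝ} (hS : S.IsSymm) (W : Finset V) (x y : V) :
    schurCov S W x y = schurCov S W y x := by
  have hA : (Matrix.of fun a b : W => S a b)⁻¹.IsSymm := by
    rw [Matrix.IsSymm, Matrix.transpose_nonsing_inv]
    congr 1
    ext a b
    exact hS.apply a b
  unfold schurCov
  rw [hS.apply y x, Finset.sum_comm]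
  congr 1
  refine Finset.sum_congr rfl fun s _ => Finset.sum_congr rfl fun t _ => ?_
  rw [hA.apply s t, hS.apply y s, hS.apply t x]
  ring

theorem schurCorr_comm {S : Matrix V V ℝ} (hS : S.IsSymm) (x y : V) (W : Finset V) :
    schurCorr S x y W = schurCorr S y x W := by
  rw [schurCorr, schurCorr, schurCov_comm hS, mul_comm (schurCov S W x x)]

end

theorem tendsto_matrix_inv {ι m : Type*} [Fintype m] [DecidableEq m] {l : Filter ι}
    {A : ι → Matrix m m ℝ} {B : Matrix m m ℝ} (hA : Tendsto A l (𝓝 B)) (hB : IsUnit B) :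
    Tendsto (fun i => (A i)⁻¹) l (𝓝 B⁻¹) := by
  have hdet : B.det ≠ 0 := ((Matrix.isUnit_iff_isUnit_det _).1 hB).ne_zero
  simp only [Matrix.inv_def, Ring.inverse_eq_inv']
  have h1 : Tendsto (fun i => (A i).det) l (𝓝 B.det) :=
    ((continuous_id.matrix_det).tendsto B).comp hA
  have h2 : Tendsto (fun i => (A i).adjugate) l (𝓝 B.adjugate) :=
    ((continuous_id.matrix_adjugate).tendsto B).comp hA
  exact (h1.inv₀ hdet).smul h2

theorem tendsto_block {ι V : Type*} {l : Filter ι} {S : ι → Matrix V V ℝ} {B : Matrix V V ℝ}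
    (hS : ∀ x y, Tendsto (fun i => S i x y) l (𝓝 (B x y))) (W : Finset V) :
    Tendsto (fun i => (Matrix.of fun a b : W => S i a b : Matrix W W ℝ)) l
      (𝓝 (Matrix.of fun a b : W => B a b)) :=
  tendsto_pi_nhds.2 fun a => tendsto_pi_nhds.2 fun b => hS a b

variable [Fintype V]

/-- The quadratic form of `S` is positive off `0`; symmetry is not part of the definition. -/
def StrictlyPositive (S : Matrix V V ℝ) : Prop := ∀ v : V → ℝ, v ≠ 0 → 0 < v ⬝ᵥ S *ᵥ v

/-- The quadratic form of `S` dominates `J` times the square of every coordinate. For a covariance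
matrix and `J > 0` this says that every variable has conditional variance at least `J` given the
others; unlike positive definiteness, it is preserved by limits. -/
def Coercive (J : ℝ) (S : Matrix V V ℝ) : Prop :=
  ∀ (v : V → ℝ) (x : V), J * v x ^ 2 ≤ v ⬝ᵥ S *ᵥ v

theorem Coercive.strictlyPositive {J : ℝ} {S : Matrix V V ℝ} (hJ : 0 < J) (h : Coercive J S) :
    StrictlyPositive S := by
  intro v hv
  obtain ⟨x, hx⟩ := Function.ne_iff.1 hv
  have := h v x
  have hx' : v x ≠ 0 := hx
  have h2 : 0 < v x ^ 2 := by positivity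
  nlinarith

variable [DecidableEq V]

theorem StrictlyPositive.isUnit_block {S : Matrix V V ℝ} (h : StrictlyPositive S) (W : Finset V) :
    IsUnit (Matrix.of fun a b : W => S a b) := by
  rw [← Matrix.mulVec_injective_iff_isUnit]
  rw [← Matrix.coe_mulVecLin, ← LinearMap.ker_eq_bot, LinearMap.ker_eq_bot']
  intro w hw
  by_contra hne
  set v : V → ℝ := fun u => if hu : u ∈ W then w ⟨u, hu⟩ else 0 with hv
  have hvW : ∀ u : W, v u = w u := fun u => by simp [hv]
  have hv0 : v ≠ 0 := by
    intro h0
    apply hne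
    funext u
    rw [← hvW u, h0]; rfl
  have hsum : ∀ f : V → ℝ, ∑ u, f u * v u = ∑ u : W, f u * w u := by
    intro f
    rw [← Finset.sum_subset (Finset.subset_univ W) (fun u _ hu => by simp [hv, hu]),
      ← Finset.sum_coe_sort W]
    simp [hvW]
  have := h v hv0
  have hq : v ⬝ᵥ S *ᵥ v = 0 := by
    rw [dotProduct_comm]
    simp only [dotProduct]
    rw [hsum]
    refine Finset.sum_eq_zero fun u _ => ?_
    have h1 := congrFun hw u
    have h2 : (S *ᵥ v) u = 0 := by
      simp only [mulVec, dotProduct]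
      rw [hsum]
      simpa [mulVec, dotProduct] using h1
    rw [h2, zero_mul]
  linarith

/-- Population regression of `z` on `W`: coefficients `β` carried by `W` that solve the normal
equations. The conditional covariances of `z` given `W` are the covariances with the residual. -/
theorem StrictlyPositive.exists_regression {S : Matrix V V ℝ} (h : StrictlyPositive S)
    (W : Finset V) (z : V) :
    ∃ β : V → ℝ, (∀ u, u ∉ W → β u = 0) ∧ (∀ s ∈ W, (S *ᵥ β) s = S s z) ∧
      ∀ y, schurCov S W y z = S y z - (S *ᵥ β) y := by
  set A : Matrix W W ℝ := Matrix.of fun a b : W => S a b with hA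
  have hu : IsUnit A.det := (Matrix.isUnit_iff_isUnit_det _).1 (h.isUnit_block W)
  set γ : W → ℝ := A⁻¹ *ᵥ fun t => S t z with hγ
  set β : V → ℝ := fun u => if hu : u ∈ W then γ ⟨u, hu⟩ else 0 with hβ
  have hsum : ∀ f : V → ℝ, ∑ u, f u * β u = ∑ u : W, f u * γ u := by
    intro f
    rw [← Finset.sum_subset (Finset.subset_univ W) (fun u _ hu => by simp [hβ, hu]),
      ← Finset.sum_coe_sort W]
    refine Finset.sum_congr rfl fun u _ => ?_
    simp [hβ]
  refine ⟨β, fun u hu => by simp [hβ, hu], fun s hs => ?_, fun y => ?_⟩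
  · have h1 : A *ᵥ γ = fun t : W => S t z := by
      rw [hγ, Matrix.mulVec_mulVec, Matrix.mul_nonsing_inv _ hu, Matrix.one_mulVec]
    have h2 := congrFun h1 ⟨s, hs⟩
    simp only [mulVec, dotProduct]
    rw [hsum]
    simpa [mulVec, dotProduct, hA] using h2
  · simp only [schurCov, mulVec, dotProduct]
    rw [hsum]
    simp only [hγ, mulVec, dotProduct, Finset.mul_sum, mul_assoc, hA]

/-- Regression coefficients are unique. -/
theorem StrictlyPositive.eq_of_mulVec_eq {S : Matrix V V ℝ} (h : StrictlyPositive S)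
    {W : Finset V} {β γ : V → ℝ} (hβ : ∀ u, u ∉ W → β u = 0) (hγ : ∀ u, u ∉ W → γ u = 0)
    (heq : ∀ s ∈ W, (S *ᵥ β) s = (S *ᵥ γ) s) : β = γ := by
  by_contra hne
  have hpos := h (β - γ) (sub_ne_zero.2 hne)
  have : (β - γ) ⬝ᵥ S *ᵥ (β - γ) = 0 := by
    refine Finset.sum_eq_zero fun u _ => ?_
    by_cases hu : u ∈ W
    · simp [Matrix.mulVec_sub, heq u hu]
    · simp [hβ u hu, hγ u hu]
  linarith

/-- Any solution of the normal equations, such as the structural coefficients, computes the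
conditional covariances. -/
theorem StrictlyPositive.schurCov_eq {S : Matrix V V ℝ} (h : StrictlyPositive S)
    {W : Finset V} {z : V} {β : V → ℝ} (hβ : ∀ u, u ∉ W → β u = 0)
    (hs : ∀ s ∈ W, (S *ᵥ β) s = S s z) (y : V) : schurCov S W y z = S y z - (S *ᵥ β) y := by
  obtain ⟨γ, h1, h2, h3⟩ := h.exists_regression W z
  rw [h.eq_of_mulVec_eq hβ h1 fun s hsW => by rw [hs s hsW, h2 s hsW]]
  exact h3 y

/-- The coefficient vector `r` of the residual of `x` regressed on `W`. -/
theorem StrictlyPositive.exists_residual {S : Matrix V V ℝ} (h : StrictlyPositive S)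
    {W : Finset V} {x : V} (hx : x ∉ W) :
    ∃ r : V → ℝ, r x = 1 ∧ (∀ u, u ∉ W → u ≠ x → r u = 0) ∧ (∀ s ∈ W, (S *ᵥ r) s = 0) ∧
      (S *ᵥ r) x = schurCov S W x x := by
  obtain ⟨β, h1, h2, h3⟩ := h.exists_regression W x
  refine ⟨Pi.single x 1 - β, by simp [h1 x hx], fun u hu hux => by simp [h1 u hu, hux],
    fun s hs => ?_, ?_⟩
  · simp [Matrix.mulVec_sub, h2 s hs]
  · simp [Matrix.mulVec_sub, h3 x]

theorem Coercive.le_schurCov {J : ℝ} {S : Matrix V V ℝ} (hJ : 0 < J) (h : Coercive J S)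
    {W : Finset V} {x : V} (hx : x ∉ W) : J ≤ schurCov S W x x := by
  obtain ⟨r, h1, h2, h3, h4⟩ := (h.strictlyPositive hJ).exists_residual hx
  have h5 : r ⬝ᵥ S *ᵥ r = schurCov S W x x := by
    rw [dotProduct, Finset.sum_eq_single x]
    · rw [h1, h4, one_mul]
    · intro u _ hux
      by_cases hu : u ∈ W
      · rw [h3 u hu, mul_zero]
      · rw [h2 u hu hux, zero_mul]
    · simp
  have := h r x
  rw [h1, h5] at this
  linarith

/-- With `r` the residual of `x` given all other variables, `v = v x • r + w` with `w x = 0` is an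
orthogonal decomposition for the form `S`, and `r` has square length the conditional variance. -/
theorem coercive_of_le_schurCov {J : ℝ} {S : Matrix V V ℝ} (hS : S.IsSymm)
    (h : StrictlyPositive S) (hJ : ∀ x, J ≤ schurCov S (Finset.univ.erase x) x x) :
    Coercive J S := by
  intro v x
  obtain ⟨r, h1, h2, h3, h4⟩ := h.exists_residual (Finset.notMem_erase x Finset.univ)
  set w : V → ℝ := v - v x • r with hw
  have hv : v = v x • r + w := by simp [hw]
  have hwx : w x = 0 := by simp [hw, h1]
  have hSr : S *ᵥ r = Pi.single x (schurCov S (Finset.univ.erase x) x x) := by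
    funext u
    by_cases hu : u = x
    · subst hu; simp [h4]
    · rw [h3 u (by simp [hu])]; simp [hu]
  have hww : 0 ≤ w ⬝ᵥ S *ᵥ w := by
    by_cases h0 : w = 0
    · simp [h0]
    · exact (h w h0).le
  have hrw : r ⬝ᵥ S *ᵥ w = 0 := by
    rw [Matrix.dotProduct_mulVec, ← Matrix.mulVec_transpose, hS.eq, hSr]
    simp [hwx]
  have : v ⬝ᵥ S *ᵥ v = v x ^ 2 * schurCov S (Finset.univ.erase x) x x + w ⬝ᵥ S *ᵥ w := by
    conv_lhs => rw [hv]
    simp only [Matrix.mulVec_add, Matrix.mulVec_smul, dotProduct_add, add_dotProduct,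
      smul_dotProduct, dotProduct_smul, hrw, hSr]
    simp [hwx, h1]
    ring
  rw [this]
  nlinarith [hJ x, sq_nonneg (v x)]

theorem Coercive.abs_le_one {J : ℝ} {S : Matrix V V ℝ} (hJ : 0 < J) (h : Coercive J S)
    (hS : S.IsSymm) (h1 : ∀ x, S x x = 1) (x y : V) : |S x y| ≤ 1 := by
  have key : ∀ c : ℝ, 0 ≤ (Pi.single x 1 + c • Pi.single y 1 : V → ℝ) ⬝ᵥ S *ᵥ
      (Pi.single x 1 + c • Pi.single y 1) := fun c =>
    (mul_nonneg hJ.le (sq_nonneg _)).trans (h _ x)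
  have e : ∀ c : ℝ, (Pi.single x 1 + c • Pi.single y 1 : V → ℝ) ⬝ᵥ S *ᵥ
      (Pi.single x 1 + c • Pi.single y 1) = 1 + 2 * c * S x y + c ^ 2 := by
    intro c
    simp only [Matrix.mulVec_add, Matrix.mulVec_smul, dotProduct_add, add_dotProduct,
      smul_dotProduct, dotProduct_smul]
    simp [h1, hS.apply x y]
    ring
  have k1 := key 1
  have k2 := key (-1)
  rw [e] at k1 k2
  rw [abs_le]
  constructor <;> linarith

theorem schurCorr_eq_zero_iff {J : ℝ} {S : Matrix V V ℝ} (hJ : 0 < J) (h : Coercive J S)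
    {W : Finset V} {x y : V} (hx : x ∉ W) (hy : y ∉ W) :
    schurCorr S x y W = 0 ↔ schurCov S W x y = 0 := by
  have h1 := h.le_schurCov hJ hx
  have h2 := h.le_schurCov hJ hy
  rw [schurCorr, div_eq_zero_iff, Real.sqrt_eq_zero']
  constructor
  · rintro (h | h)
    · exact h
    · nlinarith
  · exact Or.inl

theorem tendsto_schurCov {ι : Type*} {l : Filter ι} {S : ι → Matrix V V ℝ} {B : Matrix V V ℝ}
    (hB : StrictlyPositive B) (hS : ∀ x y, Tendsto (fun i => S i x y) l (𝓝 (B x y)))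
    (W : Finset V) (x y : V) :
    Tendsto (fun i => schurCov (S i) W x y) l (𝓝 (schurCov B W x y)) := by
  have hinv := tendsto_matrix_inv (tendsto_block hS W) (hB.isUnit_block W)
  refine (hS x y).sub (tendsto_finsetSum _ fun s _ => tendsto_finsetSum _ fun t _ => ?_)
  exact ((hS x s).mul ((tendsto_pi_nhds.1 ((tendsto_pi_nhds.1 hinv) s)) t)).mul (hS t y)

theorem tendsto_schurCorr {ι : Type*} {l : Filter ι} {S : ι → Matrix V V ℝ} {B : Matrix V V ℝ}
    {J : ℝ} (hJ : 0 < J) (hB : Coercive J B)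
    (hS : ∀ x y, Tendsto (fun i => S i x y) l (𝓝 (B x y)))
    {W : Finset V} {x y : V} (hx : x ∉ W) (hy : y ∉ W) :
    Tendsto (fun i => schurCorr (S i) x y W) l (𝓝 (schurCorr B x y W)) := by
  have hc := tendsto_schurCov (hB.strictlyPositive hJ) hS W
  have h1 := hB.le_schurCov hJ hx
  have h2 := hB.le_schurCov hJ hy
  refine (hc x y).div ((hc x x).mul (hc y y)).sqrt ?_
  exact (Real.sqrt_pos.2 (by nlinarith)).ne'

/-- Solutions of converging normal equations converge, uniformly in the choice of a solution. -/
theorem eventually_abs_regression_sub_le {ι : Type*} {l : Filter ι} {S : ι → Matrix V V ℝ}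
    {B : Matrix V V ℝ} (hB : StrictlyPositive B)
    (hS : ∀ x y, Tendsto (fun i => S i x y) l (𝓝 (B x y))) {W : Finset V} {z : V} {γ : V → ℝ}
    (hγ : ∀ s ∈ W, ∑ u ∈ W, B s u * γ u = B s z) {u : V} (hu : u ∈ W) {ε : ℝ} (hε : 0 < ε) :
    ∀ᶠ i in l, ∀ β : V → ℝ, (∀ s ∈ W, ∑ v ∈ W, S i s v * β v = S i s z) → |β u - γ u| ≤ ε := by
  have hblock := tendsto_block hS W
  have hBu := hB.isUnit_block W
  have hinv := tendsto_matrix_inv hblock hBu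
  have hdet : ∀ᶠ i in l, (Matrix.of fun a b : W => S i a b : Matrix W W ℝ).det ≠ 0 :=
    (((continuous_id.matrix_det).tendsto _).comp hblock).eventually_ne
      ((Matrix.isUnit_iff_isUnit_det _).1 hBu).ne_zero
  have solve : ∀ (A : Matrix V V ℝ) (b : V → ℝ),
      (Matrix.of fun a b : W => A a b : Matrix W W ℝ).det ≠ 0 →
      (∀ s ∈ W, ∑ u ∈ W, A s u * b u = A s z) →
      b u = ∑ t : W, (Matrix.of fun a b : W => A a b : Matrix W W ℝ)⁻¹ ⟨u, hu⟩ t * A t z := by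
    intro A b hA hb
    have h1 : (Matrix.of fun a b : W => A a b : Matrix W W ℝ) *ᵥ (fun t : W => b t) =
        fun t : W => A t z := by
      funext s
      rw [← hb s s.2, ← Finset.sum_coe_sort W]
      rfl
    have h2 := congrArg ((Matrix.of fun a b : W => A a b : Matrix W W ℝ)⁻¹ *ᵥ ·) h1
    simp only [Matrix.mulVec_mulVec, Matrix.nonsing_inv_mul _ (isUnit_iff_ne_zero.2 hA),
      Matrix.one_mulVec] at h2
    exact congrFun h2 ⟨u, hu⟩
  have hlim : Tendsto (fun i => ∑ t : W,
      (Matrix.of fun a b : W => S i a b : Matrix W W ℝ)⁻¹ ⟨u, hu⟩ t * S i t z) l (𝓝 (γ u)) := by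
    rw [solve B γ ((Matrix.isUnit_iff_isUnit_det _).1 hBu).ne_zero hγ]
    exact tendsto_finsetSum _ fun t _ =>
      ((tendsto_pi_nhds.1 ((tendsto_pi_nhds.1 hinv) ⟨u, hu⟩)) t).mul (hS t z)
  filter_upwards [hdet, Metric.tendsto_nhds.1 hlim ε hε] with i hi hdist β hβ
  rw [solve (S i) β hi hβ]
  exact hdist.le

end LinearAlgebra

/-! ### Soundness of the algorithm when the tests agree with a linear model -/

section Soundness

open Matrix

theorem Digraph.IsDAG.not_adj_of_adj {V : Type*} {G : Digraph V} (hG : G.IsDAG) {x y : V}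
    (h : G.Adj x y) : ¬ G.Adj y x := fun h' => hG x (.tail (.single h) h')

theorem Digraph.mem_parents {V : Type*} [Fintype V] {G : Digraph V} {x y : V} :
    y ∈ G.parents x ↔ G.Adj y x := by simp [Digraph.parents]

theorem ExtPattern.mem_parents {V : Type*} [Fintype V] {O : ExtPattern V} {y z : V} :
    y ∈ O.parents z ↔ O.Directed y z := by simp [ExtPattern.parents]

theorem KAdj.symm {V : Type*} {T : TestFamily V} {n : ℕ} {D : Fin n → V → ℝ} {x y : V}
    (h : KAdj T n D x y) : KAdj T n D y x :=
  ⟨h.1.symm, fun S hy hx => by rw [T.zero_symm]; exact h.2 S hx hy⟩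

/-- On the data `D`, the tests are compatible with the (limiting) model `G`, `e`, `S`: nonadjacent
pairs are recognized, an accepted hypothesis holds under `S`, and zero partial correlations in
triangles imply vanishing coefficients. Nothing is asked of the tests of a zero partial
correlation for which both outcomes are possible in the limit. -/
structure TestsSound {V : Type*} [DecidableEq V] (T : TestFamily V) (n : ℕ)
    (D : Fin n → V → ℝ) (L : ℝ) (G : Digraph V) (e : V → V → ℝ) (S : Matrix V V ℝ) : Prop where
  exists_accept : ∀ x z, x ≠ z → ¬ G.Adjacent x z →
    ∃ W : Finset V, x ∉ W ∧ z ∉ W ∧ T.zero n x z W D = 0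
  zero : ∀ x z W, x ≠ z → x ∉ W → z ∉ W → T.zero n x z W D = 0 → schurCorr S x z W = 0
  diff : ∀ x z U W, x ≠ z → x ∉ U → z ∉ U → x ∉ W → z ∉ W → T.diff n x z U W D = 0 →
    L ≤ |schurCorr S x z U - schurCorr S x z W|
  triangle : ∀ x y z, G.Adjacent x y → G.Adjacent y z → G.Adjacent x z → ∀ W : Finset V,
    x ∉ W → z ∉ W → (y ∈ W ↔ G.Collider x y z) → schurCorr S x z W = 0 →
    e x z = 0 ∧ e z x = 0

theorem TestsSound.adjacent {V : Type*} [DecidableEq V] {T : TestFamily V} {n : ℕ}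
    {D : Fin n → V → ℝ} {L : ℝ} {G : Digraph V} {e : V → V → ℝ} {S : Matrix V V ℝ}
    (h : TestsSound T n D L G e S) {x y : V} (hxy : KAdj T n D x y) :
    G.Adjacent x y := by
  by_contra hn
  obtain ⟨W, h1, h2, h3⟩ := h.exists_accept x y hxy.1 hn
  rw [hxy.2 W h1 h2] at h3
  exact absurd h3 (by decide)

variable {V : Type*} [Fintype V]

/-- `S` is the covariance matrix of a linear model on the DAG `G` with coefficients `e`. The error
terms enter only through `markov`: the error of `z` is uncorrelated with the nondescendants of `z`.
All conditions are closed, so they pass to limits of models on `G`; coefficients of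
edges may vanish in the limit. -/
structure CovModel (J : ℝ) (G : Digraph V) (e : V → V → ℝ) (S : Matrix V V ℝ) : Prop where
  isDAG : G.IsDAG
  coef_eq_zero : ∀ x y, ¬ G.Adj x y → e x y = 0
  isSymm : S.IsSymm
  coercive : Coercive J S
  markov : ∀ y z, y ≠ z → ¬ Relation.TransGen G.Adj z y → (S *ᵥ fun x => e x z) y = S y z

namespace CovModel

variable {J : ℝ} {G : Digraph V} {e : V → V → ℝ} {S : Matrix V V ℝ}

theorem mulVec_parent (h : CovModel J G e S) {s z : V} (hs : G.Adj s z) :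
    (S *ᵥ fun x => e x z) s = S s z := by
  refine h.markov s z ?_ fun ht => h.isDAG z (ht.tail hs)
  rintro rfl
  exact h.isDAG s (.single hs)

variable [DecidableEq V]

/-- If the coefficient of `x → z` vanishes and `x` is a nondescendant of `z`, then `z` is
conditionally uncorrelated with `x` given its other parents: the structural coefficients solve the
normal equations. -/
theorem schurCorr_eq_zero (hJ : 0 < J) (h : CovModel J G e S) {x z : V} (hxz : x ≠ z)
    (he : e x z = 0) (hd : ¬ Relation.TransGen G.Adj z x) :
    schurCorr S x z ((G.parents z).erase x) = 0 := by
  have hz : z ∉ (G.parents z).erase x := fun hz =>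
    h.isDAG z (.single (Digraph.mem_parents.1 (Finset.mem_of_mem_erase hz)))
  rw [schurCorr_eq_zero_iff hJ h.coercive (Finset.notMem_erase _ _) hz,
    (h.coercive.strictlyPositive hJ).schurCov_eq (β := fun x => e x z) (fun u hu => ?_)
      (fun s hs => h.mulVec_parent (Digraph.mem_parents.1 (Finset.mem_of_mem_erase hs))),
    h.markov x z hxz hd, sub_self]
  by_cases hux : u = x
  · rw [hux, he]
  · refine h.coef_eq_zero u z fun hu' => hu ?_
    exact Finset.mem_erase.2 ⟨hux, Digraph.mem_parents.2 hu'⟩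

/-- Two variables without a direct effect are separated by a set that contains their common
neighbours other than colliders and none of the colliders. The pair may be adjacent
in `G`, if the coefficient of the edge is `0`. -/
theorem exists_separator (hJ : 0 < J) (h : CovModel J G e S) {x z : V} (hxz : x ≠ z)
    (he : e x z = 0) (he' : e z x = 0) :
    ∃ W : Finset V, x ∉ W ∧ z ∉ W ∧ schurCorr S x z W = 0 ∧
      ∀ y, G.Adjacent x y → G.Adjacent y z → (y ∈ W ↔ ¬ G.Collider x y z) := by
  -- if `x` is a nondescendant of `z`, the parents of `z` other than `x` do
  have aux : ∀ {x z : V}, x ≠ z → e x z = 0 → ¬ Relation.TransGen G.Adj z x →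
      ∃ W : Finset V, x ∉ W ∧ z ∉ W ∧ schurCorr S x z W = 0 ∧
      ∀ y, G.Adjacent x y → G.Adjacent y z → (y ∈ W ↔ ¬ G.Collider x y z) := by
    intro x z hxz he hd
    refine ⟨(G.parents z).erase x, Finset.notMem_erase _ _, fun hz => ?_,
      h.schurCorr_eq_zero hJ hxz he hd, fun y hxy hyz => ?_⟩
    · exact h.isDAG z (.single (Digraph.mem_parents.1 (Finset.mem_of_mem_erase hz)))
    · have hyx : y ≠ x := by
        rintro rfl
        rcases hxy with h' | h' <;> exact h.isDAG _ (.single h')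
      rw [Finset.mem_erase, Digraph.mem_parents, Digraph.Collider]
      constructor
      · rintro ⟨_, h1⟩ ⟨_, h2⟩
        exact h.isDAG.not_adj_of_adj h1 h2
      · intro hc
        refine ⟨hyx, by_contra fun h1 => ?_⟩
        have hzy : G.Adj z y := hyz.resolve_left h1
        rcases hxy with h2 | h2
        · exact hc ⟨h2, hzy⟩
        · exact hd (.tail (.single hzy) h2)
  -- by acyclicity one of the two variables is a nondescendant of the other
  by_cases hd : Relation.TransGen G.Adj z x
  · obtain ⟨W, h1, h2, h3, h4⟩ := aux hxz.symm he' fun h' => h.isDAG z (hd.trans h')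
    refine ⟨W, h2, h1, by rw [schurCorr_comm h.isSymm, h3], fun y hxy hyz => ?_⟩
    rw [h4 y hyz.symm hxy.symm, Digraph.Collider, Digraph.Collider, and_comm]
  · exact aux hxz he hd

/-- If `S` satisfies the local Markov condition for a subgraph `H`, then the edges missing from `H`
have coefficient `0`: the regression of `z` on its parents in `H` also solves the normal equations
for its parents in `G`, hence agrees with the structural coefficients. -/
theorem coef_eq_zero_of_markov (hJ : 0 < J) (h : CovModel J G e S) {H : Digraph V}
    (hH : ∀ x y, H.Adj x y → G.Adj x y)
    (hM : ∀ x y, x ≠ y → ¬ H.Adj y x → ¬ Relation.TransGen H.Adj x y →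
      schurCov S (H.parents x) x y = 0) {x z : V} (hxz : ¬ H.Adj x z) : e x z = 0 := by
  have hpos := h.coercive.strictlyPositive hJ
  obtain ⟨β, h1, h2, h3⟩ := hpos.exists_regression (H.parents z) z
  have hsub : ∀ u, u ∉ G.parents z → u ∉ H.parents z := fun u hu hu' =>
    hu (Digraph.mem_parents.2 (hH _ _ (Digraph.mem_parents.1 hu')))
  have hβ : β = fun x => e x z := by
    refine hpos.eq_of_mulVec_eq (W := G.parents z) (fun u hu => h1 u (hsub u hu))
      (fun u hu => h.coef_eq_zero u z fun hu' => hu (Digraph.mem_parents.2 hu')) fun s hs => ?_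
    have hs' := Digraph.mem_parents.1 hs
    rw [h.mulVec_parent hs']
    by_cases hsH : s ∈ H.parents z
    · exact h2 s hsH
    · have h4 := hM z s (fun hzs => h.isDAG z (.single (by rwa [← hzs] at hs')))
        (fun h' => hsH (Digraph.mem_parents.2 h'))
        (fun ht => h.isDAG z ((Relation.TransGen.mono hH _ _ ht).tail hs'))
      rw [schurCov_comm h.isSymm, h3 s] at h4
      linarith
  exact (congrFun hβ x).symm.trans (h1 x fun hx => hxz (Digraph.mem_parents.1 hx))

end CovModel

namespace TestsSound

variable [DecidableEq V] {T : TestFamily V} {n : ℕ} {D : Fin n → V → ℝ} {J L : ℝ} {G : Digraph V}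
  {e : V → V → ℝ} {S : Matrix V V ℝ}

/-- A triple cannot be marked wrongly: the accepted hypothesis shows that `x` and `z` have no direct
effect on each other, by triangle-faithfulness if they are adjacent; so some separating set `U`
treats `y` correctly, and the accepted difference `≥ L` would be `0`. -/
theorem false_of_mark (hJ : 0 < J) (hL : 0 < L) (hM : CovModel J G e S)
    (h : TestsSound T n D L G e S) {x y z : V} (hu : KUnshielded T n D x y z) {W : Finset V}
    (hx : x ∉ W) (hz : z ∉ W) (hW : T.zero n x z W D = 0) (hy : y ∈ W ↔ G.Collider x y z)
    (hU : ∀ U : Finset V, x ∉ U → z ∉ U → (y ∈ U ↔ ¬ G.Collider x y z) →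
      T.diff n x z U W D = 0) : False := by
  obtain ⟨hxz, hxy, hyz, -⟩ := hu
  have hW0 := h.zero x z W hxz hx hz hW
  have he : e x z = 0 ∧ e z x = 0 := by
    by_cases ha : G.Adjacent x z
    · exact h.triangle x y z (h.adjacent hxy) (h.adjacent hyz) ha W hx hz hy hW0
    · exact ⟨hM.coef_eq_zero _ _ fun h' => ha (Or.inl h'),
        hM.coef_eq_zero _ _ fun h' => ha (Or.inr h')⟩
  obtain ⟨U, h1, h2, h3, h4⟩ := hM.exists_separator hJ hxz he.1 he.2
  have h5 := h.diff x z U W hxz h1 h2 hx hz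
    (hU U h1 h2 (h4 y (h.adjacent hxy) (h.adjacent hyz)))
  rw [h3, hW0] at h5
  simp at h5
  linarith

theorem collider_of_mark (hJ : 0 < J) (hL : 0 < L) (hM : CovModel J G e S)
    (h : TestsSound T n D L G e S) {x y z : V} (hm : MarkCollider T n D x y z) :
    G.Collider x y z := by
  obtain ⟨hu, W, hx, hz, hy, hW, hU⟩ := hm
  by_contra hc
  exact h.false_of_mark hJ hL hM hu hx hz hW (by tauto)
    fun U h1 h2 h3 => (hU U h1 h2 (h3.2 hc)).2

theorem not_collider_of_mark (hJ : 0 < J) (hL : 0 < L) (hM : CovModel J G e S)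
    (h : TestsSound T n D L G e S) {x y z : V} (hm : MarkNoncollider T n D x y z) :
    ¬ G.Collider x y z := by
  obtain ⟨hu, W, hx, hz, hy, hW, hU⟩ := hm
  intro hc
  exact h.false_of_mark hJ hL hM hu hx hz hW (by tauto)
    fun U h1 h2 h3 => (hU U h1 h2 fun h' => h3.1 h' hc).2

/-- All arrowheads and noncollider marks that the CSGS algorithm produces are right for `G`. -/
theorem csgs_sound (hJ : 0 < J) (hL : 0 < L) (hM : CovModel J G e S)
    (h : TestsSound T n D L G e S) {O : ExtPattern V}
    (hO : Relation.ReflTransGen ExtPattern.Step (afterS3 T n D) O) :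
    O.adj = KAdj T n D ∧ O.noncol = MarkNoncollider T n D ∧
      ∀ x y, O.head x y → G.Adj x y ∧ KAdj T n D x y := by
  induction hO with
  | refl =>
    refine ⟨rfl, rfl, ?_⟩
    rintro x y ⟨z, hz⟩
    exact ⟨(h.collider_of_mark hJ hL hM hz).1, hz.1.2.1⟩
  | tail _ hstep ih =>
    obtain ⟨hadj, hnc, hhead⟩ := ih
    obtain ⟨y, z, ⟨⟨hyz, -, -⟩, hrule⟩, rfl⟩ := hstep
    refine ⟨hadj, hnc, ?_⟩
    rintro a b (hab | ⟨rfl, rfl⟩)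
    · exact hhead a b hab
    · rw [hadj] at hyz
      refine ⟨(h.adjacent hyz).resolve_right fun hzy => ?_, hyz⟩
      rcases hrule with ⟨x, hxy, hn⟩ | ⟨x, hyx, hxz⟩ | ⟨x, w, hxz, hwz, hn⟩
      · rw [hnc] at hn
        exact h.not_collider_of_mark hJ hL hM hn ⟨(hhead _ _ hxy.2.1).1, hzy⟩
      · exact hM.isDAG a (((Relation.TransGen.single (hhead _ _ hyx.2.1).1).tail
          (hhead _ _ hxz.2.1).1).tail hzy)
      · rw [hnc] at hn
        have key : ∀ {u}, G.Adj u b → KAdj T n D u a → G.Adj u a := fun hu hua =>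
          (h.adjacent hua).resolve_right fun hau =>
            hM.isDAG a (((Relation.TransGen.single hau).tail hu).tail hzy)
        exact h.not_collider_of_mark hJ hL hM hn
          ⟨key (hhead _ _ hxz.2.1).1 hn.1.2.1, key (hhead _ _ hwz.2.1).1 hn.1.2.2.1.symm⟩

/-- If the nonadjacencies are confirmed, the output is right for the model: absent and reversed
edges have coefficient `0`, and the structural coefficients of a fully oriented variable are its
regression coefficients on its parents in `O`. -/
theorem output_sound (hJ : 0 < J) (hL : 0 < L) (hM : CovModel J G e S)
    (h : TestsSound T n D L G e S) {O : ExtPattern V} (hO : IsCSGSOutput T n D O)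
    (hC : O.Confirmed T n D) :
    (∀ x y, ¬ O.adj x y → e x y = 0) ∧
    (∀ x y, O.Directed y x → e x y = 0) ∧
    (∀ z, O.FullyOriented z →
      ∀ s ∈ O.parents z, ∑ u ∈ O.parents z, S s u * e u z = S s z) := by
  obtain ⟨hadj, hnc, hhead⟩ := h.csgs_sound hJ hL hM hO.1
  set H : Digraph V := { Adj := fun x y => G.Adj x y ∧ KAdj T n D x y } with hH
  have hHG : ∀ x y, H.Adj x y → G.Adj x y := fun x y h' => h'.1
  have hDAG : H.IsDAG := fun x hx => hM.isDAG x (Relation.TransGen.mono hHG _ _ hx)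
  -- the confirmation refers to the restriction `H` of the true graph, since `O` represents `H`
  have hrep : O.Represents H := by
    refine ⟨hDAG, fun x y => ?_, hhead, fun x y z hn hc => ?_⟩
    · rw [hadj]
      constructor
      · rintro (h' | h')
        exacts [h'.2, h'.2.symm]
      · intro hK
        exact (h.adjacent hK).imp (fun h' => ⟨h', hK⟩) fun h' => ⟨h', hK.symm⟩
    · rw [hnc] at hn
      exact h.not_collider_of_mark hJ hL hM hn ⟨hc.1.1, hc.2.1⟩
  -- edges of `G` that were removed by mistake have coefficient `0`
  have hzero : ∀ {x z}, ¬ H.Adj x z → e x z = 0 := by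
    refine fun {x z} => hM.coef_eq_zero_of_markov hJ hHG fun x y hxy h1 h2 => ?_
    have hx : x ∉ H.parents x := fun hx => hDAG x (.single (Digraph.mem_parents.1 hx))
    have hy : y ∉ H.parents x := fun hy => h1 (Digraph.mem_parents.1 hy)
    exact (schurCorr_eq_zero_iff hJ hM.coercive hx hy).1
      (h.zero x y _ hxy hx hy (hC H hrep x y hxy h1 h2))
  refine ⟨fun x y hn => hzero fun h' => hn (hadj ▸ h'.2), fun x y hd => ?_, fun z hz s hs => ?_⟩
  · exact hM.coef_eq_zero x y (hM.isDAG.not_adj_of_adj (hhead _ _ hd.2.1).1)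
  · rw [← hM.mulVec_parent (hhead _ _ (ExtPattern.mem_parents.1 hs).2.1).1]
    refine Finset.sum_subset (Finset.subset_univ _) fun u _ hu => ?_
    rw [hzero, mul_zero]
    intro huz
    rcases hz u (hadj ▸ huz.2) with h' | h'
    · exact hu (ExtPattern.mem_parents.2 h')
    · exact hM.isDAG.not_adj_of_adj huz.1 (hhead _ _ h'.2.1).1

end TestsSound

end Soundness

/-! ### The law of a linear Gaussian model -/

namespace LinGaussSEM

open Matrix

variable {V : Type*} [Fintype V] (M : LinGaussSEM V)

instance : IsProbabilityMeasure M.errLaw := by unfold errLaw; infer_instance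

theorem map_eval_errLaw (x : V) :
    M.errLaw.map (fun ε : V → ℝ => ε x) = gaussianReal 0 (M.errVar x) :=
  (measurePreserving_eval (fun x => gaussianReal 0 (M.errVar x)) x).map_eq

theorem iIndepFun_errLaw : iIndepFun (fun (x : V) (ε : V → ℝ) => ε x) M.errLaw :=
  iIndepFun_pi (X := fun _ => id) fun _ => aemeasurable_id

theorem hasGaussianLaw_eval_errLaw (x : V) :
    HasGaussianLaw (fun ε : V → ℝ => ε x) M.errLaw where
  isGaussian_map := by rw [map_eval_errLaw]; infer_instance

instance isGaussian_errLaw : IsGaussian M.errLaw := by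
  have h := iIndepFun.hasGaussianLaw (fun x => M.hasGaussianLaw_eval_errLaw x) M.iIndepFun_errLaw
  have h2 := h.isGaussian_map
  have : M.errLaw.map (fun ω x => ω x) = M.errLaw := Measure.map_id
  rwa [this] at h2

variable [DecidableEq V]

theorem solution_eq : M.solution =
    (Matrix.mulVecLin ((1 : Matrix V V ℝ) - M.coefMatrix)⁻¹).toContinuousLinearMap := rfl

instance isGaussian_law : IsGaussian M.law := by
  rw [law, solution_eq]
  infer_instance

theorem hasGaussianLaw_eval (x : V) : HasGaussianLaw (fun ω : V → ℝ => ω x) M.law :=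
  HasGaussianLaw.eval (X := fun x (ω : V → ℝ) => ω x) (IsGaussian.hasGaussianLaw_id (μ := M.law)) x

theorem covariance_errLaw (a b : V) :
    cov[fun ε : V → ℝ => ε a, fun ε => ε b; M.errLaw] =
      (Matrix.diagonal fun x => (M.errVar x : ℝ)) a b := by
  by_cases hab : a = b
  · subst hab
    rw [Matrix.diagonal_apply_eq, covariance_self (measurable_pi_apply a).aemeasurable,
      ← variance_id_gaussianReal (μ := 0) (v := M.errVar a), ← M.map_eval_errLaw a,
      variance_map aemeasurable_id (measurable_pi_apply a).aemeasurable]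
    rfl
  · rw [Matrix.diagonal_apply_ne _ hab]
    exact (M.iIndepFun_errLaw.indepFun hab).covariance_eq_zero
      (M.hasGaussianLaw_eval_errLaw a).memLp_two (M.hasGaussianLaw_eval_errLaw b).memLp_two

theorem covMatrix_law : covMatrix M.law = ((1 : Matrix V V ℝ) - M.coefMatrix)⁻¹ *
    (Matrix.diagonal fun x => (M.errVar x : ℝ)) * (((1 : Matrix V V ℝ) - M.coefMatrix)⁻¹)ᵀ := by
  set A := ((1 : Matrix V V ℝ) - M.coefMatrix)⁻¹ with hA
  ext x y
  have hm : Measurable M.solution := by rw [solution_eq]; fun_prop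
  have h1 : covMatrix M.law x y = cov[fun ε => ∑ a, A x a * ε a, fun ε => ∑ b, A y b * ε b;
      M.errLaw] := by
    change cov[_, _; M.errLaw.map M.solution] = _
    rw [covariance_map_fun (measurable_pi_apply x).aestronglyMeasurable
      (measurable_pi_apply y).aestronglyMeasurable hm.aemeasurable]
    rfl
  have hL : ∀ z a, MemLp (fun ε : V → ℝ => A z a * ε a) 2 M.errLaw := fun z a =>
    (M.hasGaussianLaw_eval_errLaw a).memLp_two.const_mul _
  rw [h1, covariance_fun_sum_fun_sum (hL x) (hL y)]
  simp only [covariance_const_mul_left, covariance_const_mul_right, covariance_errLaw,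
    Matrix.mul_apply, Matrix.transpose_apply, Finset.sum_mul]
  rw [Finset.sum_comm]
  exact Finset.sum_congr rfl fun b _ => Finset.sum_congr rfl fun a _ => by ring

/-- The error of `z` only influences `z` and its descendants. -/
theorem inv_apply_eq_zero {y z : V} (hyz : y ≠ z) (hd : ¬ Relation.TransGen M.graph.Adj z y) :
    ((1 : Matrix V V ℝ) - M.coefMatrix)⁻¹ y z = 0 := by
  have hsol := (M.solution_iff (Pi.single z 1) _).1 rfl
  have hX : ∀ y, M.solution (Pi.single z 1) y = ((1 : Matrix V V ℝ) - M.coefMatrix)⁻¹ y z := by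
    intro y
    simp [solution]
  rw [← hX]
  have : IsTrans V (Relation.TransGen M.graph.Adj) := ⟨fun _ _ _ => Relation.TransGen.trans⟩
  have : Std.Irrefl (Relation.TransGen M.graph.Adj) := ⟨M.isDAG⟩
  have wf := Finite.wellFounded_of_trans_of_irrefl (Relation.TransGen M.graph.Adj)
  induction y using wf.induction with
  | _ y ih =>
    rw [hsol y, Pi.single_eq_of_ne hyz, add_zero]
    refine Finset.sum_eq_zero fun x _ => ?_
    by_cases hxy : M.graph.Adj x y
    · rw [ih x (.single hxy) (by rintro rfl; exact hd (.single hxy)) fun h => hd (h.tail hxy),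
        mul_zero]
    · rw [M.coef_eq_zero x y hxy, zero_mul]

/-- The error of `z` is uncorrelated with each nondescendant `y` of `z`. -/
theorem markov {y z : V} (hyz : y ≠ z) (hd : ¬ Relation.TransGen M.graph.Adj z y) :
    (covMatrix M.law *ᵥ fun x => M.coef x z) y = covMatrix M.law y z := by
  have hdet := (Matrix.isUnit_iff_isUnit_det _).1 M.isUnit_one_sub_coefMatrix
  have h1 : covMatrix M.law * ((1 : Matrix V V ℝ) - M.coefMatrix)ᵀ =
      ((1 : Matrix V V ℝ) - M.coefMatrix)⁻¹ * (Matrix.diagonal fun x => (M.errVar x : ℝ)) := by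
    rw [covMatrix_law, Matrix.mul_assoc, ← Matrix.transpose_mul, Matrix.mul_nonsing_inv _ hdet]
    simp
  have h2 := congrFun (congrFun h1 y) z
  rw [Matrix.mul_diagonal, M.inv_apply_eq_zero hyz hd, zero_mul, Matrix.transpose_sub,
    Matrix.mul_sub, Matrix.transpose_one, Matrix.mul_one, Matrix.sub_apply] at h2
  exact (sub_eq_zero.1 h2).symm

theorem strictlyPositive_covMatrix : StrictlyPositive (covMatrix M.law) := by
  intro v hv
  set A := ((1 : Matrix V V ℝ) - M.coefMatrix)⁻¹ with hA
  have hdet := (Matrix.isUnit_iff_isUnit_det _).1 M.isUnit_one_sub_coefMatrix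
  have hw : Aᵀ *ᵥ v ≠ 0 := by
    intro h0
    apply hv
    have := congrArg (((1 : Matrix V V ℝ) - M.coefMatrix)ᵀ *ᵥ ·) h0
    simpa only [Matrix.mulVec_mulVec, ← Matrix.transpose_mul, hA, Matrix.mulVec_zero,
      Matrix.nonsing_inv_mul _ hdet, Matrix.transpose_one, Matrix.one_mulVec] using this
  have h1 : v ⬝ᵥ covMatrix M.law *ᵥ v = ∑ a, (M.errVar a : ℝ) * (Aᵀ *ᵥ v) a ^ 2 := by
    rw [covMatrix_law, ← Matrix.mulVec_mulVec, ← Matrix.mulVec_mulVec, Matrix.dotProduct_mulVec,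
      ← Matrix.mulVec_transpose]
    refine Finset.sum_congr rfl fun a _ => ?_
    rw [Matrix.mulVec_diagonal]
    ring
  rw [h1]
  obtain ⟨a, ha⟩ := Function.ne_iff.1 hw
  have ha' : (Aᵀ *ᵥ v) a ≠ 0 := ha
  refine Finset.sum_pos' (fun b _ => by positivity) ⟨a, Finset.mem_univ _, ?_⟩
  have := M.errVar_pos a
  positivity

theorem coercive_covMatrix {J : ℝ} (h : M.NVV J) : Coercive J (covMatrix M.law) :=
  coercive_of_le_schurCov (isSymm_covMatrix _) M.strictlyPositive_covMatrix h

theorem covModel {J : ℝ} (h : M.NVV J) : CovModel J M.graph M.coef (covMatrix M.law) where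
  isDAG := M.isDAG
  coef_eq_zero := M.coef_eq_zero
  isSymm := isSymm_covMatrix _
  coercive := M.coercive_covMatrix h
  markov _ _ := M.markov

theorem integral_eval (x : V) : ∫ ω : V → ℝ, ω x ∂M.law = 0 := by
  have h : ∀ a, ∫ ε : V → ℝ, ε a ∂M.errLaw = 0 := by
    intro a
    rw [← integral_map (φ := fun ε : V → ℝ => ε a) (f := fun t : ℝ => t)
      (measurable_pi_apply a).aemeasurable (by fun_prop), map_eval_errLaw, integral_id_gaussianReal]
  have hm : Measurable M.solution := by rw [solution_eq]; fun_prop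
  rw [law, integral_map hm.aemeasurable (measurable_pi_apply x).aestronglyMeasurable]
  change ∫ ε, ∑ a, ((1 : Matrix V V ℝ) - M.coefMatrix)⁻¹ x a * ε a ∂M.errLaw = 0
  rw [integral_finsetSum _ fun a _ => (M.hasGaussianLaw_eval_errLaw a).integrable.const_mul _]
  simp [integral_const_mul, h]

theorem map_eval_law (h : M.Standardized) (x : V) :
    M.law.map (fun ω : V → ℝ => ω x) = gaussianReal 0 1 := by
  rw [(M.hasGaussianLaw_eval x).map_eq_gaussianReal, M.integral_eval, ← covariance_self
    (measurable_pi_apply x).aemeasurable]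
  have := h x
  rw [covP] at this
  rw [this, Real.toNNReal_one]

end LinGaussSEM

/-! ### Sample moments and least squares -/

section Sample

variable {V : Type*} {n : ℕ}

/-- Sample mean; it is `0` for the empty sample. -/
def sampleMean (D : Fin n → V → ℝ) (x : V) : ℝ := (∑ t, D t x) / n

/-- Sample second moment, not centred. -/
def sampleMoment (D : Fin n → V → ℝ) (x y : V) : ℝ := (∑ t, D t x * D t y) / n

/-- Sample covariance matrix, with denominator `n`. -/
def sampleCov (D : Fin n → V → ℝ) : Matrix V V ℝ :=
  Matrix.of fun x y => sampleMoment D x y - sampleMean D x * sampleMean D y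

/-- First-order condition for least squares in the direction `d`. -/
theorem sum_mul_eq_zero_of_forall_le {ι : Type*} [Fintype ι] (r d : ι → ℝ)
    (h : ∀ c : ℝ, ∑ t, r t ^ 2 ≤ ∑ t, (r t - c * d t) ^ 2) : ∑ t, r t * d t = 0 := by
  set A := ∑ t, r t * d t with hA
  set B := ∑ t, d t ^ 2 with hB
  have hB0 : 0 ≤ B := Finset.sum_nonneg fun t _ => sq_nonneg _
  have key : ∀ c : ℝ, 0 ≤ -2 * c * A + c ^ 2 * B := by
    intro c
    have e : ∑ t, (r t - c * d t) ^ 2 = ∑ t, r t ^ 2 + (-2 * c * A + c ^ 2 * B) := by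
      rw [hA, hB, Finset.mul_sum, Finset.mul_sum, ← Finset.sum_add_distrib,
        ← Finset.sum_add_distrib]
      exact Finset.sum_congr rfl fun t _ => by ring
    have := h c
    linarith
  -- `B` may be `0`, so `B + 1` replaces it in the minimizing `c`
  have h1 := key (A / (B + 1))
  have h2 : -2 * (A / (B + 1)) * A + (A / (B + 1)) ^ 2 * B =
      -(A ^ 2 * (B + 2) / (B + 1) ^ 2) := by
    field_simp
    ring
  rw [h2] at h1
  by_contra hne
  have : 0 < A ^ 2 * (B + 2) / (B + 1) ^ 2 := by positivity
  linarith

/-- Normal equations for least squares with intercept; they hold trivially for the empty sample,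
where all sample moments are `0`. -/
theorem IsOLS.normal_equations {D : Fin n → V → ℝ} {z : V} {S : Finset V} {β : V → ℝ}
    (h : IsOLS D z S β) {s : V} (hs : s ∈ S) :
    ∑ u ∈ S, sampleCov D s u * β u = sampleCov D s z := by
  classical
  obtain ⟨a, ha⟩ := h
  rcases Nat.eq_zero_or_pos n with rfl | hn
  · simp [sampleCov, sampleMoment, sampleMean]
  have hn' : (n : ℝ) ≠ 0 := by positivity
  have h0 : ∑ t, (D t z - a - ∑ u ∈ S, β u * D t u) * 1 = 0 := by
    refine sum_mul_eq_zero_of_forall_le _ _ fun c => (ha (a + c) β).trans_eq ?_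
    exact Finset.sum_congr rfl fun t _ => by ring
  have h1 : ∑ t, (D t z - a - ∑ u ∈ S, β u * D t u) * D t s = 0 := by
    refine sum_mul_eq_zero_of_forall_le _ _ fun c =>
      (ha a fun u => β u + if u = s then c else 0).trans_eq ?_
    refine Finset.sum_congr rfl fun t _ => ?_
    have : ∑ u ∈ S, (β u + if u = s then c else 0) * D t u =
        ∑ u ∈ S, β u * D t u + c * D t s := by
      simp [add_mul, Finset.sum_add_distrib, hs]
    rw [this]
    ring
  have e0 : sampleMean D z = a + ∑ u ∈ S, β u * sampleMean D u := by
    have : ∑ u ∈ S, β u * sampleMean D u = (∑ t, ∑ u ∈ S, β u * D t u) / n := by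
      rw [Finset.sum_comm, Finset.sum_div]
      exact Finset.sum_congr rfl fun u _ => by rw [sampleMean, ← Finset.mul_sum, mul_div_assoc]
    rw [this, sampleMean]
    simp only [mul_one, Finset.sum_sub_distrib, Finset.sum_const, Finset.card_univ,
      Fintype.card_fin, nsmul_eq_mul] at h0
    field_simp
    linarith
  have e1 : sampleMoment D s z = a * sampleMean D s + ∑ u ∈ S, β u * sampleMoment D s u := by
    have : ∑ u ∈ S, β u * sampleMoment D s u = (∑ t, (∑ u ∈ S, β u * D t u) * D t s) / n := by
      simp only [Finset.sum_mul]
      rw [Finset.sum_comm, Finset.sum_div]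
      refine Finset.sum_congr rfl fun u _ => ?_
      rw [sampleMoment, ← mul_div_assoc, Finset.mul_sum]
      congr 1
      exact Finset.sum_congr rfl fun t _ => by ring
    rw [this, sampleMoment, sampleMean]
    simp only [sub_mul, Finset.sum_sub_distrib, ← Finset.mul_sum] at h1
    have h2 : ∑ t, D t s * D t z = ∑ t, D t z * D t s :=
      Finset.sum_congr rfl fun t _ => mul_comm _ _
    rw [h2]
    field_simp
    linarith
  have e2 : ∑ u ∈ S, sampleCov D s u * β u =
      ∑ u ∈ S, β u * sampleMoment D s u - sampleMean D s * ∑ u ∈ S, β u * sampleMean D u := by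
    rw [Finset.mul_sum, ← Finset.sum_sub_distrib]
    exact Finset.sum_congr rfl fun u _ => by simp only [sampleCov, Matrix.of_apply]; ring
  rw [e2, sampleCov, Matrix.of_apply, e1, e0]
  ring

end Sample

/-! ### Uniform concentration of sample moments -/

section Concentration

theorem sq_mul_le (a b : ℝ) : (a * b) ^ 2 ≤ (a ^ 4 + b ^ 4) / 2 := by
  nlinarith [sq_nonneg (a ^ 2 - b ^ 2)]

variable {V : Type*} [Fintype V]

/-- Chebyshev's inequality for the average of `f` over an i.i.d. sample. -/
theorem iidSample_average_le {P : Measure (V → ℝ)} [IsProbabilityMeasure P] {f : (V → ℝ) → ℝ}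
    (hf : MemLp f 2 P) {K η : ℝ} (hK : Var[f; P] ≤ K) (hη : 0 < η) {n : ℕ} (hn : 0 < n) :
    iidSample P n {D | η ≤ |(∑ t, f (D t)) / n - ∫ ω, f ω ∂P|} ≤
      ENNReal.ofReal (K / η ^ 2 / n) := by
  have hn' : (0 : ℝ) < n := by exact_mod_cast hn
  have : IsProbabilityMeasure (iidSample P n) := by unfold iidSample; infer_instance
  set X : (Fin n → V → ℝ) → ℝ := ∑ t, fun D => f (D t) with hX
  have hXD : ∀ D, X D = ∑ t, f (D t) := fun D => by simp [hX]
  have hLt : ∀ t : Fin n, MemLp (fun D : Fin n → V → ℝ => f (D t)) 2 (iidSample P n) := fun t =>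
    hf.comp_measurePreserving (measurePreserving_eval (fun _ : Fin n => P) t)
  have hXL : MemLp X 2 (iidSample P n) := memLp_finsetSum' _ fun t _ => hLt t
  have hvar : Var[X; iidSample P n] = n * Var[f; P] := by
    rw [hX, iidSample, variance_sum_pi (μ := fun _ : Fin n => P) (X := fun _ => f) fun _ => hf]
    simp
  have hmean : ∫ D, X D ∂iidSample P n = n * ∫ ω, f ω ∂P := by
    simp only [hXD]
    rw [integral_finsetSum _ fun t _ => (hLt t).integrable (by norm_num)]
    have : ∀ t : Fin n, ∫ D, f (D t) ∂iidSample P n = ∫ ω, f ω ∂P := by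
      intro t
      have hmp := measurePreserving_eval (fun _ : Fin n => P) t
      have hfm : AEStronglyMeasurable f
          ((Measure.pi fun _ : Fin n => P).map (Function.eval t)) := by
        rw [hmp.map_eq]
        exact hf.aestronglyMeasurable
      have := integral_map hmp.measurable.aemeasurable hfm
      rw [hmp.map_eq] at this
      exact this.symm
    simp [this]
  have hch := meas_ge_le_variance_div_sq hXL (c := η * n) (by positivity)
  rw [hvar, hmean] at hch
  refine (measure_mono fun D hD => ?_).trans (hch.trans (ENNReal.ofReal_le_ofReal ?_))
  · simp only [Set.mem_ofPred_eq] at hD ⊢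
    have e : X D - n * ∫ ω, f ω ∂P = ((∑ t, f (D t)) / n - ∫ ω, f ω ∂P) * n := by
      rw [hXD]; field_simp
    rw [e, abs_mul, abs_of_pos hn']
    exact mul_le_mul_of_nonneg_right hD hn'.le
  · have e : n * Var[f; P] / (η * n) ^ 2 = Var[f; P] / η ^ 2 / n := by field_simp
    rw [e]
    gcongr

variable [DecidableEq V]

namespace LinGaussSEM

variable (M : LinGaussSEM V)

theorem memLp_eval (x : V) {p : ℝ≥0∞} (hp : p ≠ ∞) : MemLp (fun ω : V → ℝ => ω x) p M.law :=
  (M.hasGaussianLaw_eval x).memLp hp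

theorem integrable_pow_four (x : V) : Integrable (fun ω : V → ℝ => ω x ^ 4) M.law := by
  have := (M.memLp_eval x (p := (4 : ℕ)) (by simp)).integrable_norm_pow (by norm_num)
  simpa [abs_pow, Even.pow_abs (by decide : Even 4)] using this

theorem integral_pow_four (h : M.Standardized) (x : V) :
    ∫ ω : V → ℝ, ω x ^ 4 ∂M.law = ∫ t, t ^ 4 ∂gaussianReal 0 1 := by
  rw [← M.map_eval_law h x, integral_map (measurable_pi_apply x).aemeasurable (by fun_prop)]

theorem memLp_mul (x y : V) : MemLp (fun ω : V → ℝ => ω x * ω y) 2 M.law := by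
  have hm : AEStronglyMeasurable (fun ω : V → ℝ => ω x * ω y) M.law :=
    (((measurable_pi_apply x).mul (measurable_pi_apply y)).aestronglyMeasurable)
  rw [memLp_two_iff_integrable_sq hm]
  refine (((M.integrable_pow_four x).add (M.integrable_pow_four y)).div_const 2).mono'
    (hm.pow 2) (ae_of_all _ fun ω => ?_)
  rw [Real.norm_of_nonneg (sq_nonneg _)]
  exact sq_mul_le _ _

/-- The bound does not depend on the model: the fourth moment of a standard Gaussian. -/
theorem variance_mul_le (h : M.Standardized) (x y : V) :
    Var[fun ω : V → ℝ => ω x * ω y; M.law] ≤ ∫ t, t ^ 4 ∂gaussianReal 0 1 := by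
  have hi := M.integrable_pow_four
  refine (variance_le_expectation_sq (M.memLp_mul x y).aestronglyMeasurable).trans ?_
  calc ∫ ω : V → ℝ, (ω x * ω y) ^ 2 ∂M.law
      ≤ ∫ ω : V → ℝ, (ω x ^ 4 + ω y ^ 4) / 2 ∂M.law :=
        integral_mono (M.memLp_mul x y).integrable_sq (((hi x).add (hi y)).div_const 2)
          fun ω => sq_mul_le _ _
    _ = _ := by
        rw [integral_div, integral_add (hi x) (hi y), M.integral_pow_four h,
          M.integral_pow_four h]
        ring

theorem integral_mul (x y : V) : ∫ ω : V → ℝ, ω x * ω y ∂M.law = covMatrix M.law x y := by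
  have := covariance_eq_sub (M.memLp_eval x (p := 2) (by simp)) (M.memLp_eval y (p := 2) (by simp))
  rw [M.integral_eval, zero_mul, sub_zero] at this
  exact this.symm

theorem variance_eval (h : M.Standardized) (x : V) : Var[fun ω : V → ℝ => ω x; M.law] = 1 := by
  rw [← covariance_self (measurable_pi_apply x).aemeasurable]
  exact h x

theorem sampleMean_le (h : M.Standardized) (x : V) {η : ℝ} (hη : 0 < η) {n : ℕ} (hn : 0 < n) :
    iidSample M.law n {D | η ≤ |sampleMean D x|} ≤ ENNReal.ofReal (1 / η ^ 2 / n) := by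
  have := iidSample_average_le (M.memLp_eval x (p := 2) (by simp)) (M.variance_eval h x).le hη hn
  simpa [M.integral_eval, sampleMean] using this

theorem sampleMoment_le (h : M.Standardized) (x y : V) {η : ℝ} (hη : 0 < η) {n : ℕ}
    (hn : 0 < n) :
    iidSample M.law n {D | η ≤ |sampleMoment D x y - covMatrix M.law x y|} ≤
      ENNReal.ofReal ((∫ t, t ^ 4 ∂gaussianReal 0 1) / η ^ 2 / n) := by
  have := iidSample_average_le (M.memLp_mul x y) (M.variance_mul_le h x y) hη hn
  rwa [M.integral_mul] at this

end LinGaussSEM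

end Concentration

/-! ### Limits of models and accurate samples -/

section Limits

open Matrix

variable {V : Type*} [Fintype V] {J L k : ℝ}

/-- Limits of models on a fixed graph are models on that graph. -/
theorem CovModel.of_tendsto {ι : Type*} {l : Filter ι} [l.NeBot] {G : Digraph V}
    {e : ι → V → V → ℝ} {S : ι → Matrix V V ℝ} {e' : V → V → ℝ} {S' : Matrix V V ℝ}
    (h : ∀ᶠ i in l, CovModel J G (e i) (S i))
    (he : ∀ x y, Tendsto (fun i => e i x y) l (𝓝 (e' x y)))
    (hS : ∀ x y, Tendsto (fun i => S i x y) l (𝓝 (S' x y))) : CovModel J G e' S' where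
  isDAG := h.exists.choose_spec.isDAG
  coef_eq_zero x y hxy := tendsto_nhds_unique (he x y)
    (tendsto_const_nhds.congr' (h.mono fun i hi => (hi.coef_eq_zero x y hxy).symm))
  isSymm := by
    ext x y
    exact tendsto_nhds_unique (hS y x) ((hS x y).congr' (h.mono fun i hi => hi.isSymm.apply y x))
  coercive v x := by
    refine ge_of_tendsto (f := fun i => v ⬝ᵥ S i *ᵥ v) ?_ (h.mono fun i hi => hi.coercive v x)
    exact tendsto_finsetSum _ fun a _ => (tendsto_finsetSum _ fun b _ =>
      (hS a b).mul_const _).const_mul _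
  markov y z hyz hd := by
    refine tendsto_nhds_unique (f := fun i => (S i *ᵥ fun x => e i x z) y) ?_
      ((hS y z).congr' (h.mono fun i hi => (hi.markov y z hyz hd).symm))
    exact tendsto_finsetSum _ fun a _ => (hS y a).mul (he a z)

/-- The estimates are within `δ` of the coefficients of `M` if `O` is right for a model with
coefficients `e` that are within `δ / 2` of those of `M` and of the regression coefficients. -/
theorem estDist_edgeEstimate_le {O : ExtPattern V} {β : V → V → ℝ} {M : LinGaussSEM V}
    {e : V → V → ℝ} {δ : ℝ} (hδ : 0 ≤ δ) (he : ∀ x y, |M.coef x y - e x y| ≤ δ / 2)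
    (h1 : ∀ x y, ¬ O.adj x y → e x y = 0) (h2 : ∀ x y, O.Directed y x → e x y = 0)
    (h3 : ∀ y, O.FullyOriented y → ∀ x ∈ O.parents y, |β y x - e x y| ≤ δ / 2) (x y : V) :
    estDist (edgeEstimate O β x y) (M.coef x y) ≤ δ := by
  have hz : e x y = 0 → |0 - M.coef x y| ≤ δ := fun h0 => by
    have := he x y
    rw [h0, abs_sub_comm] at this
    linarith
  unfold edgeEstimate
  split_ifs with ha hb hc
  · have h4 := h3 y hb.1 x (ExtPattern.mem_parents.2 hb.2)
    have h5 := he x y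
    rw [abs_sub_comm] at h5
    have := abs_sub_le (β y x) (e x y) (M.coef x y)
    simp only [estDist]
    linarith
  · exact hz (h2 x y hc.2)
  · exact hδ
  · exact hz (h1 x y ha)

variable [DecidableEq V]

/-- In standardized models the coefficients are bounded: the explained variance of `z` is at most
`1`. -/
theorem CovModel.mul_sq_coef_le {G : Digraph V} {e : V → V → ℝ} {S : Matrix V V ℝ} (hJ : 0 < J)
    (h : CovModel J G e S) (h1 : ∀ x, S x x = 1) (x z : V) : J * e x z ^ 2 ≤ 1 := by
  set w : V → ℝ := fun x => e x z with hw
  have hww : w ⬝ᵥ S *ᵥ w = w ⬝ᵥ fun u => S u z := by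
    refine Finset.sum_congr rfl fun u _ => ?_
    by_cases hu : G.Adj u z
    · rw [h.mulVec_parent hu]
    · simp [hw, h.coef_eq_zero u z hu]
  have h2 : (w - Pi.single z 1) ⬝ᵥ S *ᵥ (w - Pi.single z 1) = 1 - w ⬝ᵥ S *ᵥ w := by
    have h3 : S *ᵥ Pi.single z (1 : ℝ) = fun u => S u z := by ext u; simp
    have h4 : Pi.single z (1 : ℝ) ⬝ᵥ S *ᵥ w = w ⬝ᵥ fun u => S u z := by
      rw [Matrix.dotProduct_mulVec, ← Matrix.mulVec_transpose, h.isSymm.eq, h3, dotProduct_comm]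
    rw [Matrix.mulVec_sub, sub_dotProduct, dotProduct_sub, dotProduct_sub, h4, h3, hww]
    simp [h1]
  have h5 := h.coercive (w - Pi.single z 1 : V → ℝ) x
  have h6 := h.coercive w x
  have h7 : 0 ≤ J * (w - Pi.single z 1 : V → ℝ) x ^ 2 := by positivity
  rw [h2] at h5
  change J * w x ^ 2 ≤ 1
  linarith

/-- Triangle-Faithfulness bounds both directed coefficients, since one of them vanishes. -/
theorem LinGaussSEM.KTriangleFaithful.mul_abs_coef_le {M : LinGaussSEM V}
    (h : M.KTriangleFaithful k) {x y z : V} (hxy : M.graph.Adjacent x y)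
    (hyz : M.graph.Adjacent y z) (hxz : M.graph.Adjacent x z) {W : Finset V} (hx : x ∉ W)
    (hz : z ∉ W) (hy : y ∈ W ↔ M.graph.Collider x y z) :
    k * |M.coef x z| ≤ |schurCorr (covMatrix M.law) x z W| ∧
      k * |M.coef z x| ≤ |schurCorr (covMatrix M.law) x z W| := by
  have h1 : k * |M.edgeCoef x z| ≤ |schurCorr (covMatrix M.law) x z W| := by
    by_cases hc : M.graph.Collider x y z
    · exact (h x y z hxy hyz hxz).2 hc W hx hz (hy.2 hc)
    · exact (h x y z hxy hyz hxz).1 hc W hx hz fun h' => hc (hy.1 h')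
  have h0 : k * |(0 : ℝ)| ≤ |schurCorr (covMatrix M.law) x z W| := by simp
  unfold LinGaussSEM.edgeCoef at h1
  split_ifs at h1 with ha
  · rw [M.coef_eq_zero z x (M.isDAG.not_adj_of_adj ha)]
    exact ⟨h1, h0⟩
  · rw [M.coef_eq_zero x z ha]
    exact ⟨h0, h1⟩

/-- The sample `D` from `M` shows no error of size `η`: hypotheses that hold exactly are accepted by
the tests of a zero partial correlation, hypotheses that fail by at least `η` are rejected by all
tests, and the sample moments are within `η` of their expectations. -/
structure SampleAccurate (T : TestFamily V) (L η : ℝ) (M : LinGaussSEM V) (n : ℕ)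
    (D : Fin n → V → ℝ) : Prop where
  accept_zero : ∀ x z W, x ≠ z → x ∉ W → z ∉ W → partialCorr M.law x z W = 0 →
    T.zero n x z W D ≠ 1
  reject_zero : ∀ x z W, x ≠ z → x ∉ W → z ∉ W → η ≤ |partialCorr M.law x z W| →
    T.zero n x z W D ≠ 0
  reject_diff : ∀ x z U W, x ≠ z → x ∉ U → z ∉ U → x ∉ W → z ∉ W →
    |partialCorr M.law x z U - partialCorr M.law x z W| ≤ L - η → T.diff n x z U W D ≠ 0
  mean : ∀ x, |sampleMean D x| < η
  moment : ∀ x y, |sampleMoment D x y - covMatrix M.law x y| < η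

theorem tendsto_of_abs_sub_lt {l : Filter ℕ} {f g η : ℕ → ℝ} {a : ℝ}
    (h : ∀ j, |f j - g j| < η j) (hη : Tendsto η l (𝓝 0)) (hg : Tendsto g l (𝓝 a)) :
    Tendsto f l (𝓝 a) := by
  have h1 : Tendsto (fun j => f j - g j) l (𝓝 0) :=
    squeeze_zero_norm (fun j => (h j).le) hη
  simpa using h1.add hg

/-- For models that converge to a model on their common graph, and samples of increasing accuracy,
the tests are eventually compatible with the limit. -/
theorem eventually_testsSound {l : Filter ℕ} [l.NeBot] (hJ : 0 < J) (hk : 0 < k)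
    {T : TestFamily V} {M : ℕ → LinGaussSEM V} {n : ℕ → ℕ} {D : (j : ℕ) → Fin (n j) → V → ℝ}
    {η : ℕ → ℝ} (hη : Tendsto η l (𝓝 0)) (hD : ∀ j, SampleAccurate T L (η j) (M j) (n j) (D j))
    (hF : ∀ j, (M j).KTriangleFaithful k) (hN : ∀ j, (M j).NVV J)
    {G : Digraph V} (hG : ∀ᶠ j in l, (M j).graph = G) {e : V → V → ℝ} {S : Matrix V V ℝ}
    (hM : CovModel J G e S) (he : ∀ x y, Tendsto (fun j => (M j).coef x y) l (𝓝 (e x y)))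
    (hS : ∀ x y, Tendsto (fun j => covMatrix (M j).law x y) l (𝓝 (S x y))) :
    ∀ᶠ j in l, TestsSound T (n j) (D j) L G e S := by
  have hcorr : ∀ {x z : V} {W : Finset V}, x ∉ W → z ∉ W →
      Tendsto (fun j => partialCorr (M j).law x z W) l (𝓝 (schurCorr S x z W)) := fun hx hz =>
    tendsto_schurCorr hJ hM.coercive hS hx hz
  have hzero : ∀ᶠ j in l, ∀ x z W, x ≠ z → x ∉ W → z ∉ W → T.zero (n j) x z W (D j) = 0 →
      schurCorr S x z W = 0 := by
    simp only [eventually_all]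
    intro x z W hxz hx hz
    by_cases h0 : schurCorr S x z W = 0
    · exact Eventually.of_forall fun _ _ => h0
    · filter_upwards [hη.eventually_lt (hcorr hx hz).abs (abs_pos.2 h0)] with j hj hacc
      exact absurd hacc ((hD j).reject_zero x z W hxz hx hz hj.le)
  have hdiff : ∀ᶠ j in l, ∀ x z U W, x ≠ z → x ∉ U → z ∉ U → x ∉ W → z ∉ W →
      T.diff (n j) x z U W (D j) = 0 → L ≤ |schurCorr S x z U - schurCorr S x z W| := by
    simp only [eventually_all]
    intro x z U W hxz hxU hzU hx hz
    by_cases h0 : L ≤ |schurCorr S x z U - schurCorr S x z W|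
    · exact Eventually.of_forall fun _ _ => h0
    · have h1 : Tendsto (fun j => L - η j) l (𝓝 L) := by simpa using hη.const_sub L
      filter_upwards [((hcorr hxU hzU).sub (hcorr hx hz)).abs.eventually_lt h1
        (not_le.1 h0)] with j hj hacc
      exact absurd hacc ((hD j).reject_diff x z U W hxz hxU hzU hx hz hj.le)
  filter_upwards [hzero, hdiff, hG] with j h1 h2 h3
  refine ⟨fun x z hxz hn => ?_, h1, h2, fun x y z hxy hyz hxz W hx hz hy h0 => ?_⟩
  · rw [← h3] at hn
    obtain ⟨W, hx, hz, hW, -⟩ := ((M j).covModel (hN j)).exists_separator hJ hxz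
      ((M j).coef_eq_zero x z fun h' => hn (Or.inl h'))
      ((M j).coef_eq_zero z x fun h' => hn (Or.inr h'))
    refine ⟨W, hx, hz, ?_⟩
    have := (hD j).accept_zero x z W hxz hx hz hW
    omega
  · have hle : ∀ᶠ i in l, k * |(M i).coef x z| ≤ |partialCorr (M i).law x z W| ∧
        k * |(M i).coef z x| ≤ |partialCorr (M i).law x z W| := by
      filter_upwards [hG] with i hi
      rw [← hi] at hxy hyz hxz hy
      exact (hF i).mul_abs_coef_le hxy hyz hxz hx hz hy
    have key : ∀ {a b : V}, (∀ᶠ i in l, k * |(M i).coef a b| ≤ |partialCorr (M i).law x z W|) →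
        e a b = 0 := by
      intro a b hab
      have := le_of_tendsto_of_tendsto ((he a b).abs.const_mul k) (hcorr hx hz).abs hab
      rw [h0, abs_zero] at this
      exact abs_nonpos_iff.1 (nonpos_of_mul_nonpos_right this hk)
    exact ⟨key (hle.mono fun i hi => hi.1), key (hle.mono fun i hi => hi.2)⟩

theorem exists_tendsto_hyperfilter {f : ℕ → ℝ} {K : ℝ} (hf : ∀ j, |f j| ≤ K) :
    ∃ a, Tendsto f (hyperfilter ℕ) (𝓝 a) := by
  obtain ⟨a, -, ha⟩ := (isCompact_Icc (a := -K) (b := K)).ultrafilter_le_nhds'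
    ((hyperfilter ℕ).map f) (Filter.mem_map.2 (univ_mem' fun j => abs_le.1 (hf j)))
  exact ⟨a, ha⟩

/-- Samples of sufficient accuracy `η` give outputs of accuracy `δ`, uniformly over the class of
models and in the sample size. Otherwise take counterexamples with `η = 1 / (j + 1)`; along a
nonprincipal ultrafilter their graphs are constant and their coefficients and covariances
converge. -/
theorem exists_accuracy (C : ℝ) (hk : 0 < k) (hJ : 0 < J) (hL : 0 < L) (T : TestFamily V) {δ : ℝ}
    (hδ : 0 < δ) :
    ∃ η : ℝ, 0 < η ∧ ∀ M ∈ modelClass V k J C, ∀ (n : ℕ) (D : Fin n → V → ℝ),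
      SampleAccurate T L η M n D → ∀ e, IsEdgeEstimationOutput T n D e → coefDist e M ≤ δ := by
  by_contra! hcon
  have hη : ∀ j : ℕ, (0 : ℝ) < 1 / ((j : ℝ) + 1) := fun j => by positivity
  choose M hM n D hD e he hbad using fun j : ℕ => hcon (1 / ((j : ℝ) + 1)) (hη j)
  have hη0 : Tendsto (fun j : ℕ => 1 / ((j : ℝ) + 1)) (hyperfilter ℕ) (𝓝 0) :=
    tendsto_one_div_add_atTop_nhds_zero_nat.mono_left Nat.hyperfilter_le_atTop
  have hmod : ∀ j, CovModel J (M j).graph (M j).coef (covMatrix (M j).law) := fun j =>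
    (M j).covModel (hM j).2.2.1
  have hstd : ∀ j x, covMatrix (M j).law x x = 1 := fun j => (hM j).1
  obtain ⟨G, hG⟩ : ∃ G, ∀ᶠ j in hyperfilter ℕ, (M j).graph = G := by
    have : Finite (Digraph V) := Finite.of_injective (fun G : Digraph V => G.Adj) fun G H h => by
      cases G; cases H; cases h; rfl
    exact Ultrafilter.eventually_exists_iff.1 (Eventually.of_forall fun j => ⟨_, rfl⟩)
  have hcoef : ∀ x y, ∃ a, Tendsto (fun j => (M j).coef x y) (hyperfilter ℕ) (𝓝 a) := by
    refine fun x y => exists_tendsto_hyperfilter (K := 1 + 1 / J) fun j => ?_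
    have h1 := (hmod j).mul_sq_coef_le hJ (hstd j) x y
    have h2 : (M j).coef x y ^ 2 ≤ 1 / J := by rw [le_div_iff₀ hJ]; linarith
    have h3 := sq_abs ((M j).coef x y)
    nlinarith [sq_nonneg (|(M j).coef x y| - 1), abs_nonneg ((M j).coef x y)]
  have hcov : ∀ x y, ∃ a, Tendsto (fun j => covMatrix (M j).law x y) (hyperfilter ℕ) (𝓝 a) :=
    fun x y => exists_tendsto_hyperfilter fun j =>
      (hmod j).coercive.abs_le_one hJ (hmod j).isSymm (hstd j) x y
  choose e' he' using hcoef
  choose S hS using hcov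
  have hlim : CovModel J G e' (S : Matrix V V ℝ) :=
    .of_tendsto (hG.mono fun j hj => hj ▸ hmod j) he' hS
  have hsound := eventually_testsSound (L := L) hJ hk hη0 hD (fun j => (hM j).2.1)
    (fun j => (hM j).2.2.1) hG hlim he' hS
  have hScov : ∀ x y, Tendsto (fun j => sampleCov (D j) x y) (hyperfilter ℕ) (𝓝 (S x y)) := by
    intro x y
    have hmean : ∀ x, Tendsto (fun j => sampleMean (D j) x) (hyperfilter ℕ) (𝓝 0) := fun x =>
      squeeze_zero_norm (fun j => ((hD j).mean x).le) hη0
    have hmom := tendsto_of_abs_sub_lt (fun j => (hD j).moment x y) hη0 (hS x y)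
    simpa [sampleCov] using hmom.sub ((hmean x).mul (hmean y))
  have hclose : ∀ᶠ j in hyperfilter ℕ, ∀ x y, |(M j).coef x y - e' x y| ≤ δ / 2 := by
    simp only [eventually_all]
    exact fun x y => (Metric.tendsto_nhds.1 (he' x y) (δ / 2) (half_pos hδ)).mono fun j hj => hj.le
  have hreg : ∀ᶠ j in hyperfilter ℕ, ∀ (y : V) (P : Finset V) (x : V), x ∈ P →
      (∀ s ∈ P, ∑ u ∈ P, S s u * e' u y = S s y) → ∀ β : V → ℝ,
      (∀ s ∈ P, ∑ u ∈ P, sampleCov (D j) s u * β u = sampleCov (D j) s y) →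
      |β x - e' x y| ≤ δ / 2 := by
    simp only [eventually_all]
    exact fun y P x hx hP => eventually_abs_regression_sub_le
      (hlim.coercive.strictlyPositive hJ) hScov (γ := fun u => e' u y) hP hx (half_pos hδ)
  obtain ⟨j, h1, h2, h3⟩ := (hsound.and (hclose.and hreg)).exists
  refine (hbad j).not_ge (Real.iSup_le (fun p => ?_) hδ.le)
  obtain ⟨O, hO, ⟨-, hnone⟩ | ⟨hC, β, hβ, hest⟩⟩ := he j
  · simp [hnone, estDist, hδ.le]
  · obtain ⟨h4, h5, h6⟩ := h1.output_sound hJ hL hlim hO hC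
    rw [hest]
    exact estDist_edgeEstimate_le hδ.le h2 h4 h5 (fun y hy x hx => h3 y _ x hx (h6 y hy) (β y)
      fun s hs => (hβ y).normal_equations hs) p.1 p.2

end Limits

/-! ### Uniformly negligible events -/

section Uniform

variable {V : Type*} [Fintype V] [DecidableEq V]

/-- The events `A M n` have (outer) probability tending to `0` uniformly over the models `M` in
`Ω`. The events need not be measurable, as tests are arbitrary functions. -/
def UniformlyNegligible (Ω : Set (LinGaussSEM V))
    (A : LinGaussSEM V → (n : ℕ) → Set (Fin n → V → ℝ)) : Prop :=
  Tendsto (fun n => ⨆ M ∈ Ω, iidSample M.law n (A M n)) atTop (𝓝 0)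

namespace UniformlyNegligible

variable {Ω : Set (LinGaussSEM V)} {A B : LinGaussSEM V → (n : ℕ) → Set (Fin n → V → ℝ)}

theorem mono (hB : UniformlyNegligible Ω B) (h : ∀ M ∈ Ω, ∀ n, A M n ⊆ B M n) :
    UniformlyNegligible Ω A :=
  tendsto_of_tendsto_of_tendsto_of_le_of_le tendsto_const_nhds hB (fun _ => zero_le)
    fun n => iSup₂_mono fun M hM => measure_mono (h M hM n)

theorem iUnion {ι : Type*} [Finite ι] {A : ι → LinGaussSEM V → (n : ℕ) → Set (Fin n → V → ℝ)}
    (h : ∀ i, UniformlyNegligible Ω (A i)) :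
    UniformlyNegligible Ω fun M n => ⋃ i, A i M n := by
  have := Fintype.ofFinite ι
  have hsum := tendsto_finsetSum Finset.univ fun i _ => h i
  rw [Finset.sum_const_zero] at hsum
  refine tendsto_of_tendsto_of_tendsto_of_le_of_le tendsto_const_nhds hsum (fun _ => zero_le)
    fun n => iSup₂_le fun M hM => (measure_iUnion_fintype_le _ _).trans ?_
  exact Finset.sum_le_sum fun i _ => le_iSup₂ (f := fun M _ => iidSample M.law n (A i M n)) M hM

theorem union (hA : UniformlyNegligible Ω A) (hB : UniformlyNegligible Ω B) :
    UniformlyNegligible Ω fun M n => A M n ∪ B M n :=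
  (iUnion (A := fun b : Bool => if b then A else B) fun b => by cases b <;> simpa).mono
    fun M _ n D hD => by simpa [or_comm] using hD

theorem of_le_div {K : ℝ} (h : ∀ M ∈ Ω, ∀ n, 0 < n →
    iidSample M.law n (A M n) ≤ ENNReal.ofReal (K / n)) : UniformlyNegligible Ω A := by
  have hlim : Tendsto (fun n : ℕ => ENNReal.ofReal (K / n)) atTop (𝓝 0) := by
    have := ENNReal.tendsto_ofReal (tendsto_const_div_atTop_nhds_zero_nat K)
    simpa using this
  refine tendsto_of_tendsto_of_tendsto_of_le_of_le' tendsto_const_nhds hlim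
    (Eventually.of_forall fun _ => zero_le) ?_
  filter_upwards [eventually_gt_atTop 0] with n hn
  exact iSup₂_le fun M hM => h M hM n hn

theorem of_tendsto_law {p : Measure (V → ℝ) → Prop} {φ : (n : ℕ) → (Fin n → V → ℝ) → Fin 2}
    {b : Fin 2}
    (h : Tendsto (fun n => ⨆ P ∈ LinGaussSEM.law '' Ω, ⨆ _ : p P, iidSample P n {D | φ n D = b})
      atTop (𝓝 0)) :
    UniformlyNegligible Ω fun M n => {D | p M.law ∧ φ n D = b} := by
  refine tendsto_of_tendsto_of_tendsto_of_le_of_le tendsto_const_nhds h (fun _ => zero_le)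
    fun n => iSup₂_le fun M hM => ?_
  by_cases hp : p M.law
  · refine le_trans (measure_mono fun D hD => hD.2) ?_
    exact (le_iSup (fun _ : p M.law => iidSample M.law n {D | φ n D = b}) hp).trans
      (le_iSup₂ (f := fun P _ => ⨆ _ : p P, iidSample P n {D | φ n D = b}) M.law ⟨M, hM, rfl⟩)
  · simp [hp]

theorem of_imp {q : Prop} (h : q → UniformlyNegligible Ω A) :
    UniformlyNegligible Ω fun M n => {D | q ∧ D ∈ A M n} := by
  by_cases hq : q
  · exact (h hq).mono fun M _ n D hD => hD.2
  · simp [UniformlyNegligible, hq]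

end UniformlyNegligible

theorem uniformlyNegligible_not_sampleAccurate {Ω : Set (LinGaussSEM V)}
    (hΩ : ∀ M ∈ Ω, M.Standardized) {T : TestFamily V} {L η : ℝ} (hη : 0 < η)
    (hT : T.UniformlyConsistent L (LinGaussSEM.law '' Ω)) :
    UniformlyNegligible Ω fun M n => {D | ¬ SampleAccurate T L η M n D} := by
  have h1 : UniformlyNegligible Ω fun M n => ⋃ i : V × V × Finset V,
      {D | (i.1 ≠ i.2.1 ∧ i.1 ∉ i.2.2 ∧ i.2.1 ∉ i.2.2) ∧
        D ∈ {D | partialCorr M.law i.1 i.2.1 i.2.2 = 0 ∧ T.zero n i.1 i.2.1 i.2.2 D = 1}} :=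
    .iUnion fun i => .of_imp fun hi =>
      .of_tendsto_law (p := fun P => partialCorr P i.1 i.2.1 i.2.2 = 0)
        (hT.1 i.1 i.2.1 i.2.2 hi.1 hi.2.1 hi.2.2).1
  have h2 : UniformlyNegligible Ω fun M n => ⋃ i : V × V × Finset V,
      {D | (i.1 ≠ i.2.1 ∧ i.1 ∉ i.2.2 ∧ i.2.1 ∉ i.2.2) ∧
        D ∈ {D | η ≤ |partialCorr M.law i.1 i.2.1 i.2.2| ∧ T.zero n i.1 i.2.1 i.2.2 D = 0}} :=
    .iUnion fun i => .of_imp fun hi =>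
      .of_tendsto_law (p := fun P => η ≤ |partialCorr P i.1 i.2.1 i.2.2|)
        ((hT.1 i.1 i.2.1 i.2.2 hi.1 hi.2.1 hi.2.2).2 η hη)
  have h3 : UniformlyNegligible Ω fun M n => ⋃ i : V × V × Finset V × Finset V,
      {D | (i.1 ≠ i.2.1 ∧ i.1 ∉ i.2.2.1 ∧ i.2.1 ∉ i.2.2.1 ∧ i.1 ∉ i.2.2.2 ∧ i.2.1 ∉ i.2.2.2) ∧
        D ∈ {D | |partialCorr M.law i.1 i.2.1 i.2.2.1 - partialCorr M.law i.1 i.2.1 i.2.2.2| ≤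
          L - η ∧ T.diff n i.1 i.2.1 i.2.2.1 i.2.2.2 D = 0}} :=
    .iUnion fun i => .of_imp fun hi =>
      .of_tendsto_law (p := fun P =>
        |partialCorr P i.1 i.2.1 i.2.2.1 - partialCorr P i.1 i.2.1 i.2.2.2| ≤ L - η)
        ((hT.2 i.1 i.2.1 i.2.2.1 i.2.2.2 hi.1 hi.2.1 hi.2.2.1 hi.2.2.2.1 hi.2.2.2.2).2 η hη)
  have h4 : UniformlyNegligible Ω fun _ n => ⋃ x : V, {D | η ≤ |sampleMean D x|} :=
    .iUnion fun x => .of_le_div fun M hM n hn => M.sampleMean_le (hΩ M hM) x hη hn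
  have h5 : UniformlyNegligible Ω fun M n => ⋃ i : V × V,
      {D | η ≤ |sampleMoment D i.1 i.2 - covMatrix M.law i.1 i.2|} :=
    .iUnion fun i => .of_le_div fun M hM n hn => M.sampleMoment_le (hΩ M hM) i.1 i.2 hη hn
  refine ((((h1.union h2).union h3).union h4).union h5).mono fun M _ n D hD => ?_
  by_contra hout
  simp only [Set.mem_union, Set.mem_iUnion, Set.mem_ofPred_eq, not_or, not_exists, not_and,
    Prod.forall, not_le] at hout
  obtain ⟨⟨⟨⟨g1, g2⟩, g3⟩, g4⟩, g5⟩ := hout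
  exact hD ⟨fun x z W a b c => g1 x z W ⟨a, b, c⟩, fun x z W a b c => g2 x z W ⟨a, b, c⟩,
    fun x z U W a b c d f => g3 x z U W ⟨a, b, c, d, f⟩, g4, g5⟩

end Uniform

end

theorem theorem2 {V : Type*} [Fintype V] [DecidableEq V]
    (k J C L : ℝ) (hk : 0 < k) (hJ : 0 < J) (hC : C < 1) (hL : 0 < L)
    (T : TestFamily V)
    (hT : T.UniformlyConsistent L (LinGaussSEM.law '' modelClass V k J C))
    (δ : ℝ) (hδ : 0 < δ) :
    Tendsto
      (fun n : ℕ => ⨆ M ∈ modelClass V k J C,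
        iidSample M.law n
          {D : Fin n → V → ℝ | ∃ e, IsEdgeEstimationOutput T n D e ∧ δ < coefDist e M})
      atTop (𝓝 0) := by
  obtain ⟨η, hη, hacc⟩ := exists_accuracy C hk hJ hL T hδ
  refine (uniformlyNegligible_not_sampleAccurate (fun M hM => hM.1) hη hT).mono
    (A := fun M n => {D | ∃ e, IsEdgeEstimationOutput T n D e ∧ δ < coefDist e M})
    fun M hM n D hD hgood => ?_
  obtain ⟨e, he, hlt⟩ := hD
  exact hlt.not_ge (hacc M hM n D hgood e he)
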